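/- There are universal constants $C_1, C_2 > 0$ such that the following holds. Let $m \ge 0$, $n \ge 1$. Let $f:\mathbb{R}^{m}\times\mathbb{R}^{n}\to\mathbb{R}$ be $\ell$-smooth (differentiable with $\|\nabla f(z)-\nabla f(z')\|\le \ell\|z-z'\|$ for all $z,z'$), with $f(x,\cdot)$ $\mu$-strongly concave on $\mathbb{R}^n$ for every $x$, where $\mu>0$. Let $\mathcal{Y}\subseteq\mathbb{R}^n$ be nonempty, closed, convex and bounded with diameter $D$, and let $\kappa=\ell/\mu$. Let $\Phi(x)=\max_{y\in\mathcal{Y}} f(x,y)$ be bounded below, let $x_0\in\mathbb{R}^m$, $y_0\in\mathcal{Y}$, and $\Delta_\Phi=\Phi(x_0)-\inf_x\Phi(x)$. Let $G=(G_x,G_y)$ be a stochastic gradient oracle: for a random datum $\xi$ and all $(x,y)$, $\mathbb{E}[G(x,y,\xi)]=\nabla f(x,y)$ and $\mathbb{E}\|G(x,y,\xi)-\nabla f(x,y)\|^2\le\sigma^2$. Let $\epsilon>0$ and $$\eta_x=\frac{1}{16(\kappa+1)^2\ell},\qquad \eta_y=\frac1\ell,\qquad M=\left\lceil\max\{1,\,26\kappa\sigma^2\epsilon^{-2}\}\right\rceil.$$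 Two-time-scale SGDA draws, in each iteration $t=1,2,\dots$, fresh i.i.d. data $\xi_1,\dots,\xi_M$, independent of the past, and sets $$x_t=x_{t-1}-\eta_x\frac1M\sum_{i=1}^M G_x(x_{t-1},y_{t-1},\xi_i),\qquad y_t=\mathcal{P}_{\mathcal{Y}}\Big(y_{t-1}+\eta_y\frac1M\sum_{i=1}^M G_y(x_{t-1},y_{t-1},\xi_i)\Big),$$ where $\mathcal{P}_{\mathcal{Y}}$ is the Euclidean projection onto $\mathcal{Y}$; after $T$ iterations it returns $\hat x$ drawn uniformly from $\{x_1,\dots,x_T\}$, independently of the data. Put $$N=\frac{\kappa^2\ell\Delta_\Phi+\kappa\ell^2D^2}{\epsilon^2},\qquad T_0=\max\{1,\lceil C_1N\rceil\}.$$ Then: (i) for every $T\ge T_0$, $\hat x$ is an $\epsilon$-stationary point of $\Phi$ in expectation: $\Phi$ is differentiable, $\mathbb{E}\|\nabla\Phi(\hat x)\|\le\epsilon$, and moreover $\mathbb{E}\|\nabla\Phi(\hat x)\|^2\le\epsilon^2$; (ii) $T_0\le C_2\max\{1,N\}$, and $T_0$ iterations use at most $C_2\max\{1,N\}\cdot\max\{1,\kappa\sigma^2\epsilon^{-2}\}$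 stochastic gradients; (iii) if $\epsilon\le\ell D$, then $T_0\le C_2N$, and $T_0$ iterations use at most $C_2N\cdot\max\{1,\kappa\sigma^2\epsilon^{-2}\}$ stochastic gradients. That is, SGDA reaches an $\epsilon$-stationary point within $O((\kappa^2\ell\Delta_\Phi+\kappa\ell^2D^2)\epsilon^{-2})$ iterations and $O((\kappa^2\ell\Delta_\Phi+\kappa\ell^2D^2)\epsilon^{-2}\max\{1,\kappa\sigma^2\epsilon^{-2}\})$ stochastic gradients. -/

import Mathlib

open MeasureTheory ProbabilityTheory Gradient

noncomputable section

/-- The space of pairs `(x, y)`, i.e. `ℝ^(m+n)` with the Euclidean norm. -/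
abbrev JointSpace (m n : ℕ) : Type :=
  WithLp 2 (EuclideanSpace ℝ (Fin m) × EuclideanSpace ℝ (Fin n))

/-- The pair `(x, y)` as a point of `ℝ^(m+n)`. -/
def joint {m n : ℕ} (x : EuclideanSpace ℝ (Fin m)) (y : EuclideanSpace ℝ (Fin n)) :
    JointSpace m n :=
  WithLp.toLp 2 (x, y)

/-- `f` is `ℓ`-smooth: differentiable, with `ℓ`-Lipschitz gradient. -/
def IsSmoothWith {E : Type*} [NormedAddCommGroup E] [InnerProductSpace ℝ E] [CompleteSpace E]
    (ℓ : ℝ) (f : E → ℝ) : Prop :=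
  Differentiable ℝ f ∧ ∀ z z' : E, ‖∇ f z - ∇ f z'‖ ≤ ℓ * ‖z - z'‖

/-- The nonconvex-strongly-concave setting: `f` is `ℓ`-smooth on `ℝ^(m+n)`, each `f(x, ·)` is
`μ`-strongly concave, and `Y` is a nonempty, closed, convex, bounded set. -/
structure NonconvexStronglyConcave {m n : ℕ} (f : JointSpace m n → ℝ)
    (Y : Set (EuclideanSpace ℝ (Fin n))) (ℓ μ : ℝ) : Prop where
  smooth : IsSmoothWith ℓ f
  mu_pos : 0 < μ
  strongConcave : ∀ x : EuclideanSpace ℝ (Fin m),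
    StrongConcaveOn Set.univ μ (fun y => f (joint x y))
  nonempty : Y.Nonempty
  closed : IsClosed Y
  convex : Convex ℝ Y
  bounded : Bornology.IsBounded Y

/-- `Φ(x) = max_{y ∈ Y} f(x, y)`. -/
def maxFun {m n : ℕ} (f : JointSpace m n → ℝ) (Y : Set (EuclideanSpace ℝ (Fin n)))
    (x : EuclideanSpace ℝ (Fin m)) : ℝ :=
  sSup ((fun y => f (joint x y)) '' Y)

/-- A stochastic gradient oracle for `f`: for a random datum of law `ν`, `G z ·` is an unbiased
estimate of the full gradient `∇ f z` with variance at most `σ ^ 2`. -/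
structure IsStochasticOracle {m n : ℕ} {Ξ : Type*} [MeasurableSpace Ξ] (ν : Measure Ξ)
    (f : JointSpace m n → ℝ) (G : JointSpace m n → Ξ → JointSpace m n) (σ : ℝ) : Prop where
  measurable : Measurable (Function.uncurry G)
  memLp : ∀ z, MemLp (G z) 2 ν
  unbiased : ∀ z, ∫ s, (G z s - ∇ f z) ∂ν = 0
  variance_le : ∀ z, ∫ s, ‖G z s - ∇ f z‖ ^ 2 ∂ν ≤ σ ^ 2

open Classical in
/-- The Euclidean projection of `v` onto `Y`: the point of `Y` nearest to `v`. It exists and is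
unique when `Y` is nonempty, closed and convex; the value is irrelevant otherwise. -/
def proj {F : Type*} [NormedAddCommGroup F] (Y : Set F) (v : F) : F :=
  if h : ∃ p ∈ Y, ∀ w ∈ Y, ‖v - p‖ ≤ ‖v - w‖ then h.choose else v

/-- The state of the algorithm: the current iterates, and the number of stochastic gradients
requested so far. -/
structure SGDAState (m n : ℕ) where
  x : EuclideanSpace ℝ (Fin m)
  y : EuclideanSpace ℝ (Fin n)
  calls : ℕ

/-- One query of the stochastic oracle: the stochastic gradient, together with its cost `1`. -/
def oracleQuery {m n : ℕ} {Ξ : Type*} (G : JointSpace m n → Ξ → JointSpace m n)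
    (z : JointSpace m n) (s : Ξ) : JointSpace m n × ℕ :=
  (G z s, 1)

/-- One iteration of SGDA with minibatch `s₁, …, s_M`: a descent step in `x` and a projected
ascent step in `y`, both along the minibatch average of stochastic gradients at `(x, y)`. -/
def sgdaStep {m n M : ℕ} {Ξ : Type*} (G : JointSpace m n → Ξ → JointSpace m n)
    (Y : Set (EuclideanSpace ℝ (Fin n))) (ηx ηy : ℝ) (s : Fin M → Ξ)
    (S : SGDAState m n) : SGDAState m n :=
  let q : Fin M → JointSpace m n × ℕ := fun i => oracleQuery G (joint S.x S.y) (s i)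
  { x := S.x - ηx • ((1 / (M : ℝ)) • ∑ i, (q i).1.fst)
    y := proj Y (S.y + ηy • ((1 / (M : ℝ)) • ∑ i, (q i).1.snd))
    calls := S.calls + ∑ i, (q i).2 }

/-- The state of SGDA after `t` iterations from `(x₀, y₀)`, where iteration `t + 1` uses the
minibatch `s t 0, …, s t (M - 1)`. -/
def sgda {m n M : ℕ} {Ξ : Type*} (G : JointSpace m n → Ξ → JointSpace m n)
    (Y : Set (EuclideanSpace ℝ (Fin n))) (ηx ηy : ℝ)
    (x₀ : EuclideanSpace ℝ (Fin m)) (y₀ : EuclideanSpace ℝ (Fin n))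
    (s : ℕ → Fin M → Ξ) : ℕ → SGDAState m n
  | 0 => ⟨x₀, y₀, 0⟩
  | t + 1 => sgdaStep G Y ηx ηy (s t) (sgda G Y ηx ηy x₀ y₀ s t)

/-- The data samples `ξ t i` (`t`-th iteration, `i`-th element of the minibatch) are i.i.d.
with law `ν`. -/
structure IsIIDSample {Ω Ξ : Type*} [MeasurableSpace Ω] [MeasurableSpace Ξ] {M : ℕ}
    (P : Measure Ω) (ν : Measure Ξ) (ξ : ℕ → Fin M → Ω → Ξ) : Prop where
  measurable : ∀ t i, Measurable (ξ t i)
  law : ∀ t i, P.map (ξ t i) = ν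
  indep : iIndepFun (fun p : ℕ × Fin M => ξ p.1 p.2) P

/-- `τ` is drawn uniformly at random from `{1, …, T}`, independently of the data samples. -/
structure IsUniformDraw {Ω Ξ : Type*} [MeasurableSpace Ω] [MeasurableSpace Ξ] {M : ℕ}
    (P : Measure Ω) (ξ : ℕ → Fin M → Ω → Ξ) (T : ℕ) (τ : Ω → ℕ) : Prop where
  measurable : Measurable τ
  law : P.map τ = uniformOn (Set.Icc 1 T)
  indep : IndepFun τ (fun ω t i => ξ t i ω) P

/-- The random point `X` is an `ε`-stationary point of the differentiable function `Φ` in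
expectation, both in the sense `𝔼 ‖∇Φ(X)‖ ≤ ε` and in mean square, `𝔼 ‖∇Φ(X)‖² ≤ ε²`. -/
def IsStationaryInExpectation {E Ω : Type*} [NormedAddCommGroup E] [InnerProductSpace ℝ E]
    [CompleteSpace E] [MeasurableSpace Ω] (P : Measure Ω) (Φ : E → ℝ) (ε : ℝ) (X : Ω → E) : Prop :=
  Differentiable ℝ Φ ∧
    (Integrable (fun ω => ‖∇ Φ (X ω)‖) P ∧ ∫ ω, ‖∇ Φ (X ω)‖ ∂P ≤ ε) ∧
    (Integrable (fun ω => ‖∇ Φ (X ω)‖ ^ 2) P ∧ ∫ ω, ‖∇ Φ (X ω)‖ ^ 2 ∂P ≤ ε ^ 2)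

end

/-!
The argument follows the Lyapunov function `V(x, y) = Φ(x) - inf Φ + ηx * κ * ℓ² * ‖y - y*(x)‖²`,
where `y*(x)` is the maximizer of `f(x, ·)` over `Y`.

Strong concavity makes `y*` a `κ`-Lipschitz function (`norm_maximizer_sub_le`). Comparing `Φ` from
below and above with `f(·, y*(x))` and `f(·, y*(x'))` then shows that `Φ` is differentiable with
`∇Φ(x) = ∇ₓ f(x, y*(x))`, and gives a descent inequality for `Φ` (`maxFun_upper`,
`hasGradientAt_maxFun`). In the dual variable, cocoercivity of the gradient of a smooth concave
function shows that an exact ascent step with step size `1 / ℓ` contracts the squared distance to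
`y*(x)` by `1 - 1 / κ` (`norm_ascent_step_sub_sq_le`), and projecting onto `Y` does not increase it.

Since `ηx` is of order `1 / (κ² ℓ)`, the target `y*(x)` moves slowly enough for the contraction to
absorb its motion. With `ζ` the error of the gradient estimate, one step changes `V` by at most
`-(ηx / 2) * ‖∇Φ(x)‖² + ⟪w, ζ⟫ + (3 / 2) * ηx * κ * ‖ζ‖²`, where `w` depends only on the current
state (`potential_step_le`). The minibatch is independent of the current state, so the linear term
has mean zero and `‖ζ‖²` has mean at most `σ² / M` (`integral_norm_minibatchGradient_sub_sq_le`,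
`IsIIDSample.lintegral_iterate_succ`). As `V ≥ 0`, all expectations can be taken as integrals of
`ENNReal`-valued functions, and telescoping bounds the sum of `𝔼 ‖∇Φ(x_t)‖²` by `V(x₀, y₀)` plus
accumulated noise (`sum_lintegral_gradient_sq_le`). The choices of `M` and `T₀` make the average at
most `ε²`, and this average is `𝔼 ‖∇Φ(x̂)‖²` because the output index is uniform and independent of
the data (`IsUniformDraw.lintegral_eq`).
-/

open MeasureTheory ProbabilityTheory Gradient

noncomputable section

/-! ### Smooth functions, gradient ascent steps and projections -/

theorem IsSmoothWith.hasDerivAt_line {E : Type*} [NormedAddCommGroup E] [InnerProductSpace ℝ E]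
    [CompleteSpace E] {ℓ : ℝ} {f : E → ℝ} (hf : IsSmoothWith ℓ f) (z d : E) (t : ℝ) :
    HasDerivAt (fun t : ℝ => f (z + t • d)) (inner ℝ (∇ f (z + t • d)) d) t := by
  have h1 : HasFDerivAt f (InnerProductSpace.toDual ℝ E (∇ f (z + t • d))) (z + t • d) :=
    (hf.1 _).hasGradientAt.hasFDerivAt
  have h2 : HasDerivAt (fun t : ℝ => z + t • d) d t := by
    simpa using ((hasDerivAt_id t).smul_const d).const_add z
  have h := h1.comp_hasDerivAt t h2
  rw [InnerProductSpace.toDual_apply_apply] at h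
  exact h

theorem IsSmoothWith.continuous {E : Type*} [NormedAddCommGroup E] [InnerProductSpace ℝ E]
    [CompleteSpace E] {ℓ : ℝ} {f : E → ℝ} (hf : IsSmoothWith ℓ f) : Continuous f :=
  hf.1.continuous

theorem IsSmoothWith.continuous_gradient {E : Type*} [NormedAddCommGroup E]
    [InnerProductSpace ℝ E] [CompleteSpace E] {ℓ : ℝ} {f : E → ℝ} (hf : IsSmoothWith ℓ f) :
    Continuous (∇ f) := by
  have : LipschitzWith (Real.toNNReal ℓ) (∇ f) := LipschitzWith.of_dist_le_mul fun z z' => by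
    rw [dist_eq_norm, dist_eq_norm]
    refine (hf.2 z z').trans ?_
    gcongr
    exact Real.le_coe_toNNReal ℓ
  exact this.continuous

/-- The descent lemma. -/
theorem IsSmoothWith.le_add_inner_add {E : Type*} [NormedAddCommGroup E] [InnerProductSpace ℝ E]
    [CompleteSpace E] {ℓ : ℝ} {f : E → ℝ} (hf : IsSmoothWith ℓ f) (z z' : E) :
    f z' ≤ f z + inner ℝ (∇ f z) (z' - z) + ℓ / 2 * ‖z' - z‖ ^ 2 := by
  set d := z' - z
  have hder : ∀ t : ℝ, HasDerivAt
      (fun t : ℝ => f (z + t • d) - t * inner ℝ (∇ f z) d - ℓ / 2 * ‖d‖ ^ 2 * t ^ 2)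
      (inner ℝ (∇ f (z + t • d)) d - inner ℝ (∇ f z) d - ℓ * ‖d‖ ^ 2 * t) t := fun t => by
    refine HasDerivAt.congr_deriv (((hf.hasDerivAt_line z d t).sub
      ((hasDerivAt_id t).mul_const (inner ℝ (∇ f z) d))).sub
      ((hasDerivAt_pow 2 t).const_mul (ℓ / 2 * ‖d‖ ^ 2))) ?_
    norm_num
    ring
  have hanti : AntitoneOn
      (fun t : ℝ => f (z + t • d) - t * inner ℝ (∇ f z) d - ℓ / 2 * ‖d‖ ^ 2 * t ^ 2)
      (Set.Icc 0 1) := by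
    refine antitoneOn_of_deriv_nonpos (convex_Icc 0 1)
      (fun t _ => (hder t).continuousAt.continuousWithinAt)
      (fun t _ => (hder t).differentiableAt.differentiableWithinAt) fun t ht => ?_
    rw [interior_Icc] at ht
    rw [(hder t).deriv, ← inner_sub_left]
    have h1 := real_inner_le_norm (∇ f (z + t • d) - ∇ f z) d
    have h2 := hf.2 (z + t • d) z
    rw [add_sub_cancel_left, norm_smul, Real.norm_of_nonneg ht.1.le] at h2
    nlinarith [mul_le_mul_of_nonneg_right h2 (norm_nonneg d)]
  have h := hanti (Set.left_mem_Icc.2 zero_le_one) (Set.right_mem_Icc.2 zero_le_one) zero_le_one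
  have hz : z + d = z' := by simp [d]
  simp only [one_smul, zero_smul, add_zero, hz] at h
  linarith

theorem IsSmoothWith.neg {E : Type*} [NormedAddCommGroup E] [InnerProductSpace ℝ E]
    [CompleteSpace E] {ℓ : ℝ} {f : E → ℝ} (hf : IsSmoothWith ℓ f) :
    IsSmoothWith ℓ (fun z => -f z) ∧ ∀ z, ∇ (fun z => -f z) z = -∇ f z := by
  have hg : ∀ z, ∇ (fun z => -f z) z = -∇ f z := fun z => by
    apply HasGradientAt.gradient
    rw [hasGradientAt_iff_hasFDerivAt, map_neg]
    exact (hf.1 z).hasGradientAt.hasFDerivAt.neg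
  refine ⟨⟨hf.1.neg, fun z z' => ?_⟩, hg⟩
  rw [hg, hg, neg_sub_neg, norm_sub_rev]
  exact hf.2 z z'

theorem IsSmoothWith.add_inner_sub_le {E : Type*} [NormedAddCommGroup E] [InnerProductSpace ℝ E]
    [CompleteSpace E] {ℓ : ℝ} {f : E → ℝ} (hf : IsSmoothWith ℓ f) (z z' : E) :
    f z + inner ℝ (∇ f z) (z' - z) - ℓ / 2 * ‖z' - z‖ ^ 2 ≤ f z' := by
  have h := hf.neg.1.le_add_inner_add z z'
  rw [hf.neg.2, inner_neg_left] at h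
  linarith

/-- A gradient ascent step with step size `1 / ℓ` on a `μ`-strongly concave, `ℓ`-smooth function is
a contraction. Both assumptions on `φ` are given as quadratic bounds with gradient field `g`. -/
theorem norm_ascent_step_sub_sq_le {F : Type*} [NormedAddCommGroup F] [InnerProductSpace ℝ F]
    {φ : F → ℝ} {g : F → F} {ℓ μ : ℝ} (hμ : 0 < μ) (hℓ : 0 < ℓ)
    (hup : ∀ y y', φ y' ≤ φ y + inner ℝ (g y) (y' - y) - μ / 2 * ‖y' - y‖ ^ 2)
    (hlow : ∀ y y', φ y + inner ℝ (g y) (y' - y) - ℓ / 2 * ‖y' - y‖ ^ 2 ≤ φ y') (y y' : F) :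
    ‖(y + (1 / ℓ) • g y) - (y' + (1 / ℓ) • g y')‖ ^ 2 ≤ (1 - μ / ℓ) * ‖y - y'‖ ^ 2 := by
  -- cocoercivity, from the two bounds at `y' + (g y' - g y) / ℓ`
  have key : ∀ y y', φ y' + 1 / (2 * ℓ) * ‖g y - g y'‖ ^ 2 ≤ φ y + inner ℝ (g y) (y' - y) := by
    intro y y'
    have h1 := hlow y' (y' + (1 / ℓ) • (g y' - g y))
    have h2 := hup y (y' + (1 / ℓ) • (g y' - g y))
    have e : y' + (1 / ℓ) • (g y' - g y) - y = (y' - y) + (1 / ℓ) • (g y' - g y) := by abel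
    rw [e, inner_add_right, inner_smul_right] at h2
    rw [add_sub_cancel_left, inner_smul_right, norm_smul, mul_pow, Real.norm_of_nonneg
      (by positivity)] at h1
    have h3 : 0 ≤ μ / 2 * ‖y' - y + (1 / ℓ) • (g y' - g y)‖ ^ 2 := by positivity
    have h4 : inner ℝ (g y') (g y' - g y) - inner ℝ (g y) (g y' - g y) = ‖g y - g y'‖ ^ 2 := by
      rw [← inner_sub_left, real_inner_self_eq_norm_sq, norm_sub_rev]
    rw [norm_sub_rev (g y') (g y)] at h1
    have h5 : ℓ / 2 * ((1 / ℓ) ^ 2 * ‖g y - g y'‖ ^ 2) = 1 / (2 * ℓ) * ‖g y - g y'‖ ^ 2 := by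
      field_simp
    have h6 : (1 / ℓ) * (inner ℝ (g y') (g y' - g y) - inner ℝ (g y) (g y' - g y)) =
      2 * (1 / (2 * ℓ) * ‖g y - g y'‖ ^ 2) := by rw [h4]; field_simp
    linarith
  have hco : 1 / ℓ * ‖g y - g y'‖ ^ 2 ≤ - inner ℝ (g y - g y') (y - y') := by
    have h1 := key y y'
    have h2 := key y' y
    rw [← neg_sub y y', inner_neg_right] at h1
    rw [norm_sub_rev] at h2
    have h5 : 1 / ℓ * ‖g y - g y'‖ ^ 2 = 2 * (1 / (2 * ℓ) * ‖g y - g y'‖ ^ 2) := by field_simp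
    rw [inner_sub_left]
    linarith
  have hmono : μ * ‖y - y'‖ ^ 2 ≤ - inner ℝ (g y - g y') (y - y') := by
    have h1 := hup y y'
    have h2 := hup y' y
    rw [← neg_sub y y', inner_neg_right, norm_neg] at h1
    rw [inner_sub_left]
    linarith
  have e : (y + (1 / ℓ) • g y) - (y' + (1 / ℓ) • g y') = (y - y') + (1 / ℓ) • (g y - g y') := by
    rw [smul_sub]; abel
  rw [e, norm_add_sq_real, inner_smul_right, norm_smul, mul_pow,
    Real.norm_of_nonneg (by positivity), real_inner_comm]
  have h0 : (0 : ℝ) < 1 / ℓ := by positivity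
  have h1 := mul_le_mul_of_nonneg_left hco h0.le
  have h2 := mul_le_mul_of_nonneg_left hmono h0.le
  have h3 : 1 / ℓ * (μ * ‖y - y'‖ ^ 2) = μ / ℓ * ‖y - y'‖ ^ 2 := by ring
  linarith

/-- The first-order optimality condition at a maximizer `p` of `φ` over a convex set, for a vector
`v` that supports `φ` at `p` from below up to a quadratic term. -/
theorem inner_le_zero_of_isMaxOn {F : Type*} [NormedAddCommGroup F] [InnerProductSpace ℝ F]
    {φ : F → ℝ} {Y : Set F} (hY : Convex ℝ Y) {v p : F} {ℓ : ℝ} (hℓ : 0 ≤ ℓ)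
    (hlow : ∀ y, φ p + inner ℝ v (y - p) - ℓ / 2 * ‖y - p‖ ^ 2 ≤ φ y)
    (hp : p ∈ Y) (hmax : ∀ w ∈ Y, φ w ≤ φ p) {y : F} (hy : y ∈ Y) : inner ℝ v (y - p) ≤ 0 := by
  by_contra! hpos
  have key : ∀ t : ℝ, 0 < t → t ≤ 1 → inner ℝ v (y - p) ≤ t * (ℓ / 2 * ‖y - p‖ ^ 2) := by
    intro t ht ht1
    have hmem : p + t • (y - p) ∈ Y := hY.add_smul_sub_mem hp hy ⟨ht.le, ht1⟩
    have h1 := hlow (p + t • (y - p))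
    have h2 := hmax _ hmem
    rw [add_sub_cancel_left, inner_smul_right, norm_smul, Real.norm_of_nonneg ht.le] at h1
    have h3 : t * inner ℝ v (y - p) ≤ t * (t * (ℓ / 2 * ‖y - p‖ ^ 2)) := by linarith
    exact le_of_mul_le_mul_left h3 ht
  -- `t = A / (2 A + B)` lies in `(0, 1]` and is small enough for a contradiction
  set A := inner ℝ v (y - p)
  set B := ℓ / 2 * ‖y - p‖ ^ 2
  have hB : 0 ≤ B := by positivity
  have h := key (A / (A + B + A)) (by positivity) (by rw [div_le_one (by positivity)]; linarith)
  rw [div_mul_eq_mul_div, le_div_iff₀ (by positivity)] at h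
  nlinarith [mul_nonneg hpos.le hB, mul_pos hpos hpos]

theorem proj_spec {F : Type*} [NormedAddCommGroup F] [InnerProductSpace ℝ F] [CompleteSpace F]
    {Y : Set F} (hne : Y.Nonempty) (hc : IsClosed Y) (hY : Convex ℝ Y) (v : F) :
    proj Y v ∈ Y ∧ ∀ w ∈ Y, inner ℝ (v - proj Y v) (w - proj Y v) ≤ 0 := by
  have hex : ∃ p ∈ Y, ∀ w ∈ Y, ‖v - p‖ ≤ ‖v - w‖ := by
    obtain ⟨p, hp, h⟩ := exists_norm_eq_iInf_of_complete_convex hne hc.isComplete hY v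
    refine ⟨p, hp, fun w hw => ?_⟩
    rw [h]
    exact ciInf_le ⟨0, by rintro _ ⟨w, rfl⟩; exact norm_nonneg _⟩ (⟨w, hw⟩ : Y)
  have hs := hex.choose_spec
  have e : proj Y v = hex.choose := by rw [proj, dif_pos hex]
  rw [← e] at hs
  refine ⟨hs.1, ?_⟩
  rw [← norm_eq_iInf_iff_real_inner_le_zero hY hs.1]
  have := hne.to_subtype
  exact le_antisymm (le_ciInf fun w => hs.2 w w.2)
    (ciInf_le ⟨0, by rintro _ ⟨w, rfl⟩; exact norm_nonneg _⟩ (⟨_, hs.1⟩ : Y))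

/-- The projection is nonexpansive relative to a point `u` with projection `p`, where the latter is
expressed by the variational inequality. -/
theorem norm_proj_sub_le {F : Type*} [NormedAddCommGroup F] [InnerProductSpace ℝ F]
    [CompleteSpace F] {Y : Set F} (hne : Y.Nonempty) (hc : IsClosed Y) (hY : Convex ℝ Y)
    {p u : F} (hp : p ∈ Y) (hu : ∀ w ∈ Y, inner ℝ (u - p) (w - p) ≤ 0) (v : F) :
    ‖proj Y v - p‖ ≤ ‖v - u‖ := by
  obtain ⟨hq, hv⟩ := proj_spec hne hc hY v
  set q := proj Y v
  have h1 := hv p hp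
  have h2 := hu q hq
  have h3 : ‖q - p‖ ^ 2 ≤ inner ℝ (v - u) (q - p) := by
    rw [← real_inner_self_eq_norm_sq]
    have e : v - u = (v - q) + (q - p) - (u - p) := by abel
    rw [e, inner_sub_left (v - q + (q - p)), inner_add_left]
    rw [← neg_sub q p, inner_neg_right] at h1
    linarith
  have h4 := h3.trans (real_inner_le_norm _ _)
  by_contra! hlt
  nlinarith [norm_nonneg (v - u), norm_nonneg (q - p)]

theorem continuous_proj {F : Type*} [NormedAddCommGroup F] [InnerProductSpace ℝ F]
    [CompleteSpace F] {Y : Set F} (hne : Y.Nonempty) (hc : IsClosed Y) (hY : Convex ℝ Y) :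
    Continuous (proj Y) := by
  have : LipschitzWith 1 (proj Y) := LipschitzWith.of_dist_le_mul fun v u => by
    obtain ⟨hq, hu⟩ := proj_spec hne hc hY u
    simpa [dist_eq_norm] using norm_proj_sub_le hne hc hY hq hu v
  exact this.continuous

/-! ### The maximizer and the gradient of the max-function -/

section Minimax

open Filter Topology

variable {m n : ℕ} {f : JointSpace m n → ℝ} {Y : Set (EuclideanSpace ℝ (Fin n))} {ℓ μ : ℝ}

theorem norm_joint_sub_sq (x x' : EuclideanSpace ℝ (Fin m)) (y y' : EuclideanSpace ℝ (Fin n)) :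
    ‖joint x y - joint x' y'‖ ^ 2 = ‖x - x'‖ ^ 2 + ‖y - y'‖ ^ 2 :=
  WithLp.prod_norm_sq_eq_of_L2 _

theorem inner_joint_sub (v : JointSpace m n) (x x' : EuclideanSpace ℝ (Fin m))
    (y y' : EuclideanSpace ℝ (Fin n)) :
    inner ℝ v (joint x y - joint x' y') = inner ℝ v.fst (x - x') + inner ℝ v.snd (y - y') :=
  WithLp.prod_inner_apply _ _

theorem norm_joint_fst_le (v : JointSpace m n) : ‖v.fst‖ ≤ ‖v‖ := by
  have := WithLp.prod_norm_sq_eq_of_L2 v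
  exact le_of_sq_le_sq (by nlinarith [sq_nonneg ‖v.snd‖]) (norm_nonneg _)

theorem norm_joint_snd_le (v : JointSpace m n) : ‖v.snd‖ ≤ ‖v‖ := by
  have := WithLp.prod_norm_sq_eq_of_L2 v
  exact le_of_sq_le_sq (by nlinarith [sq_nonneg ‖v.fst‖]) (norm_nonneg _)

theorem continuous_joint :
    Continuous fun p : EuclideanSpace ℝ (Fin m) × EuclideanSpace ℝ (Fin n) => joint p.1 p.2 :=
  WithLp.prod_continuous_toLp 2 _ _

open Classical in
/-- The maximizer `y*(x)` of `f(x, ·)` over `Y`, with junk value `0` if there is none. -/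
def maximizer (f : JointSpace m n → ℝ) (Y : Set (EuclideanSpace ℝ (Fin n)))
    (x : EuclideanSpace ℝ (Fin m)) : EuclideanSpace ℝ (Fin n) :=
  if h : ∃ y ∈ Y, ∀ w ∈ Y, f (joint x w) ≤ f (joint x y) then h.choose else 0

namespace NonconvexStronglyConcave

theorem maximizer_spec (hf : NonconvexStronglyConcave f Y ℓ μ) (x : EuclideanSpace ℝ (Fin m)) :
    maximizer f Y x ∈ Y ∧ ∀ w ∈ Y, f (joint x w) ≤ f (joint x (maximizer f Y x)) := by
  have hcomp : IsCompact Y := Metric.isCompact_of_isClosed_isBounded hf.closed hf.bounded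
  have hcont : Continuous fun y => f (joint x y) :=
    hf.smooth.continuous.comp (continuous_joint.comp (by fun_prop : Continuous fun y => (x, y)))
  have h : ∃ y ∈ Y, ∀ w ∈ Y, f (joint x w) ≤ f (joint x y) :=
    hcomp.exists_isMaxOn hf.nonempty hcont.continuousOn
  rw [maximizer, dif_pos h]
  exact h.choose_spec

theorem maxFun_eq (hf : NonconvexStronglyConcave f Y ℓ μ) (x : EuclideanSpace ℝ (Fin m)) :
    maxFun f Y x = f (joint x (maximizer f Y x)) := by
  obtain ⟨h1, h2⟩ := hf.maximizer_spec x
  exact IsGreatest.csSup_eq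
    ⟨⟨_, h1, rfl⟩, by rintro _ ⟨w, hw, rfl⟩; exact h2 w hw⟩

/-- The first-order form of strong concavity: the limit `t → 0` of the defining inequality for the
point `(1 - t) y + t y'`. -/
theorem le_add_inner_sub (hf : NonconvexStronglyConcave f Y ℓ μ) (x : EuclideanSpace ℝ (Fin m))
    (y y' : EuclideanSpace ℝ (Fin n)) :
    f (joint x y') ≤ f (joint x y) + inner ℝ (∇ f (joint x y)).snd (y' - y)
      - μ / 2 * ‖y' - y‖ ^ 2 := by
  have hd := hf.smooth.hasDerivAt_line (joint x y) (joint x y' - joint x y) 0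
  rw [zero_smul, add_zero, inner_joint_sub, sub_self, inner_zero_right, zero_add] at hd
  have hlim := (hasDerivAt_iff_tendsto_slope_zero.1 hd).mono_left
    (nhdsWithin_mono 0 (fun t (ht : 0 < t) => ht.ne') : 𝓝[>] (0 : ℝ) ≤ _)
  have hlim2 : Tendsto (fun t : ℝ => f (joint x y') - f (joint x y)
      + (1 - t) * (μ / 2 * ‖y' - y‖ ^ 2)) (𝓝[>] 0)
      (𝓝 (f (joint x y') - f (joint x y) + (1 - 0) * (μ / 2 * ‖y' - y‖ ^ 2))) :=
    (Continuous.tendsto (by fun_prop) 0).mono_left nhdsWithin_le_nhds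
  have hle := le_of_tendsto_of_tendsto hlim2 hlim ?_
  · linarith
  filter_upwards [Ioo_mem_nhdsGT (zero_lt_one' ℝ)] with t ht
  have h := (hf.strongConcave x).2 (Set.mem_univ y) (Set.mem_univ y') (sub_nonneg.2 ht.2.le)
    ht.1.le (by ring)
  have e : joint x y + (0 + t) • (joint x y' - joint x y) = joint x ((1 - t) • y + t • y') := by
    apply (WithLp.equiv 2 _).injective
    refine Prod.ext ?_ ?_
    · simp [joint]
    · simp only [joint, zero_add, WithLp.equiv_apply, WithLp.ofLp_add, WithLp.ofLp_smul,
        WithLp.ofLp_sub, Prod.snd_add, Prod.smul_snd, Prod.snd_sub]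
      module
  rw [e, zero_smul, add_zero, smul_eq_mul, inv_mul_eq_div, le_div_iff₀ ht.1]
  rw [norm_sub_rev] at h
  simp only [smul_eq_mul] at h
  nlinarith

theorem partial_lower (hf : NonconvexStronglyConcave f Y ℓ μ) (x : EuclideanSpace ℝ (Fin m))
    (y y' : EuclideanSpace ℝ (Fin n)) :
    f (joint x y) + inner ℝ (∇ f (joint x y)).snd (y' - y) - ℓ / 2 * ‖y' - y‖ ^ 2
      ≤ f (joint x y') := by
  have h := hf.smooth.add_inner_sub_le (joint x y) (joint x y')
  rwa [norm_joint_sub_sq, inner_joint_sub, sub_self, inner_zero_right, zero_add, norm_zero,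
    zero_pow two_ne_zero, zero_add] at h

/-- Smoothness and strong concavity in a space of positive dimension force `κ ≥ 1`. -/
theorem mu_le (hf : NonconvexStronglyConcave f Y ℓ μ) (hn : 1 ≤ n) : μ ≤ ℓ := by
  have : Nonempty (Fin n) := ⟨⟨0, hn⟩⟩
  obtain ⟨y, hy⟩ := exists_ne (0 : EuclideanSpace ℝ (Fin n))
  have h1 := hf.le_add_inner_sub 0 0 y
  have h2 := hf.partial_lower 0 0 y
  rw [sub_zero] at h1 h2
  have h3 : 0 < ‖y‖ ^ 2 := by positivity
  nlinarith

theorem ell_pos (hf : NonconvexStronglyConcave f Y ℓ μ) (hn : 1 ≤ n) : 0 < ℓ :=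
  hf.mu_pos.trans_le (hf.mu_le hn)

/-- The variational inequality for the maximizer. -/
theorem inner_gradient_maximizer_le (hf : NonconvexStronglyConcave f Y ℓ μ) (hn : 1 ≤ n)
    (x : EuclideanSpace ℝ (Fin m)) {y : EuclideanSpace ℝ (Fin n)} (hy : y ∈ Y) :
    inner ℝ (∇ f (joint x (maximizer f Y x))).snd (y - maximizer f Y x) ≤ 0 :=
  inner_le_zero_of_isMaxOn (φ := fun y => f (joint x y)) hf.convex (hf.ell_pos hn).le
    (fun y => hf.partial_lower x _ y) (hf.maximizer_spec x).1 (hf.maximizer_spec x).2 hy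

theorem norm_maximizer_sub_le (hf : NonconvexStronglyConcave f Y ℓ μ) (hn : 1 ≤ n)
    (x x' : EuclideanSpace ℝ (Fin m)) :
    ‖maximizer f Y x - maximizer f Y x'‖ ≤ ℓ / μ * ‖x - x'‖ := by
  set p := maximizer f Y x with hp
  set q := maximizer f Y x' with hq
  have h1 := hf.inner_gradient_maximizer_le hn x (hf.maximizer_spec x').1
  have h2 := hf.inner_gradient_maximizer_le hn x' (hf.maximizer_spec x).1
  rw [← hp, ← hq] at h1 h2
  have h3 := hf.le_add_inner_sub x p q
  have h4 := hf.le_add_inner_sub x q p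
  rw [norm_sub_rev q p] at h3
  have h5 : μ * ‖p - q‖ ^ 2 ≤ inner ℝ (∇ f (joint x q) - ∇ f (joint x' q)).snd (p - q) := by
    rw [WithLp.sub_snd, inner_sub_left]
    linarith
  have h6 := hf.smooth.2 (joint x q) (joint x' q)
  have h7 : ‖joint x q - joint x' q‖ = ‖x - x'‖ := by
    have := norm_joint_sub_sq x x' q q
    rw [sub_self, norm_zero, zero_pow two_ne_zero, add_zero] at this
    exact (sq_eq_sq₀ (norm_nonneg _) (norm_nonneg _)).1 this
  rw [h7] at h6
  have h8 := h5.trans ((real_inner_le_norm _ _).trans (mul_le_mul_of_nonneg_right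
    ((norm_joint_snd_le _).trans h6) (norm_nonneg _)))
  have hμ := hf.mu_pos
  rw [div_mul_eq_mul_div, le_div_iff₀ hμ]
  rcases (norm_nonneg (p - q)).eq_or_lt with h0 | h0
  · rw [← h0, zero_mul]
    exact mul_nonneg (hf.ell_pos hn).le (norm_nonneg _)
  · nlinarith

theorem continuous_maximizer (hf : NonconvexStronglyConcave f Y ℓ μ) (hn : 1 ≤ n) :
    Continuous (maximizer f Y) := by
  have : LipschitzWith (Real.toNNReal (ℓ / μ)) (maximizer f Y) :=
    LipschitzWith.of_dist_le_mul fun x x' => by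
      rw [dist_eq_norm, dist_eq_norm, Real.coe_toNNReal _
        (div_nonneg (hf.ell_pos hn).le hf.mu_pos.le)]
      exact hf.norm_maximizer_sub_le hn x x'
  exact this.continuous

theorem maxFun_lower (hf : NonconvexStronglyConcave f Y ℓ μ) (x x' : EuclideanSpace ℝ (Fin m)) :
    maxFun f Y x + inner ℝ (∇ f (joint x (maximizer f Y x))).fst (x' - x)
      - ℓ / 2 * ‖x' - x‖ ^ 2 ≤ maxFun f Y x' := by
  rw [hf.maxFun_eq x, hf.maxFun_eq x']
  have h := hf.smooth.add_inner_sub_le (joint x (maximizer f Y x)) (joint x' (maximizer f Y x))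
  rw [norm_joint_sub_sq, inner_joint_sub, sub_self, inner_zero_right, add_zero, norm_zero,
    zero_pow two_ne_zero, add_zero] at h
  exact h.trans ((hf.maximizer_spec x').2 _ (hf.maximizer_spec x).1)

/-- The descent inequality for `Φ`. The extra curvature `ℓ * κ` comes from the motion of the
maximizer. -/
theorem maxFun_upper (hf : NonconvexStronglyConcave f Y ℓ μ) (hn : 1 ≤ n)
    (x x' : EuclideanSpace ℝ (Fin m)) :
    maxFun f Y x' ≤ maxFun f Y x + inner ℝ (∇ f (joint x (maximizer f Y x))).fst (x' - x)
      + ℓ * (ℓ / μ + 1 / 2) * ‖x' - x‖ ^ 2 := by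
  rw [hf.maxFun_eq x, hf.maxFun_eq x']
  set p := maximizer f Y x with hp
  set q := maximizer f Y x' with hq
  have h := hf.smooth.le_add_inner_add (joint x q) (joint x' q)
  rw [norm_joint_sub_sq, inner_joint_sub, sub_self, inner_zero_right, add_zero, norm_zero,
    zero_pow two_ne_zero, add_zero] at h
  have h1 := (hf.maximizer_spec x).2 q (hf.maximizer_spec x').1
  have h2 : inner ℝ (∇ f (joint x q) - ∇ f (joint x p)).fst (x' - x)
      ≤ ℓ * (ℓ / μ * ‖x' - x‖) * ‖x' - x‖ := by
    refine (real_inner_le_norm _ _).trans (mul_le_mul_of_nonneg_right ?_ (norm_nonneg _))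
    refine (norm_joint_fst_le _).trans ((hf.smooth.2 _ _).trans
      (mul_le_mul_of_nonneg_left ?_ (hf.ell_pos hn).le))
    have h7 : ‖joint x q - joint x p‖ = ‖q - p‖ := by
      have := norm_joint_sub_sq x x q p
      rw [sub_self, norm_zero, zero_pow two_ne_zero, zero_add] at this
      exact (sq_eq_sq₀ (norm_nonneg _) (norm_nonneg _)).1 this
    rw [h7]
    exact hf.norm_maximizer_sub_le hn x' x
  rw [WithLp.sub_fst, inner_sub_left] at h2
  rw [← hp] at h1
  linarith

/-- Danskin's theorem: `∇Φ(x) = ∇ₓ f(x, y*(x))`. -/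
theorem hasGradientAt_maxFun (hf : NonconvexStronglyConcave f Y ℓ μ) (hn : 1 ≤ n)
    (x : EuclideanSpace ℝ (Fin m)) :
    HasGradientAt (maxFun f Y) (∇ f (joint x (maximizer f Y x))).fst x := by
  rw [hasGradientAt_iff_isLittleO]
  have hO : (fun x' => maxFun f Y x' - maxFun f Y x
      - inner ℝ (∇ f (joint x (maximizer f Y x))).fst (x' - x))
      =O[𝓝 x] fun x' => ‖x' - x‖ ^ 2 := by
    refine Asymptotics.IsBigO.of_bound (ℓ * (ℓ / μ + 1 / 2)) (Eventually.of_forall fun x' => ?_)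
    have h1 := hf.maxFun_lower x x'
    have h2 := hf.maxFun_upper hn x x'
    have hℓ := hf.ell_pos hn
    have h3 : 0 ≤ ℓ * (ℓ / μ) * ‖x' - x‖ ^ 2 :=
      mul_nonneg (mul_nonneg hℓ.le (div_nonneg hℓ.le hf.mu_pos.le)) (by positivity)
    rw [Real.norm_eq_abs, norm_pow, norm_norm, abs_le]
    constructor <;> linarith
  refine hO.trans_isLittleO ?_
  have h2 : (fun x' => ‖x' - x‖ ^ 2) =o[𝓝 x] fun x' => ‖x' - x‖ ^ 1 := by
    refine (Asymptotics.isLittleO_pow_pow one_lt_two).comp_tendsto (k := fun x' => ‖x' - x‖) ?_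
    have : Tendsto (fun x' => ‖x' - x‖) (𝓝 x) (𝓝 ‖x - x‖) := Continuous.tendsto (by fun_prop) x
    simpa using this
  simpa using h2.norm_right

theorem gradient_maxFun (hf : NonconvexStronglyConcave f Y ℓ μ) (hn : 1 ≤ n)
    (x : EuclideanSpace ℝ (Fin m)) :
    ∇ (maxFun f Y) x = (∇ f (joint x (maximizer f Y x))).fst :=
  (hf.hasGradientAt_maxFun hn x).gradient

theorem differentiable_maxFun (hf : NonconvexStronglyConcave f Y ℓ μ) (hn : 1 ≤ n) :
    Differentiable ℝ (maxFun f Y) :=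
  fun x => (hf.hasGradientAt_maxFun hn x).differentiableAt

theorem continuous_gradient_maxFun (hf : NonconvexStronglyConcave f Y ℓ μ) (hn : 1 ≤ n) :
    Continuous (∇ (maxFun f Y)) := by
  rw [funext (hf.gradient_maxFun hn)]
  exact (WithLp.prod_continuous_ofLp 2 _ _).fst.comp (hf.smooth.continuous_gradient.comp
    (continuous_joint.comp (continuous_id.prodMk (hf.continuous_maximizer hn))))

end NonconvexStronglyConcave

end Minimax

/-! ### Deterministic descent of the Lyapunov function -/

section OneStep

variable {m n : ℕ} {f : JointSpace m n → ℝ} {Y : Set (EuclideanSpace ℝ (Fin n))} {ℓ μ : ℝ}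

/-- The Lyapunov function `Φ(x) + c * ‖y - y*(x)‖²`. -/
def potential (f : JointSpace m n → ℝ) (Y : Set (EuclideanSpace ℝ (Fin n))) (c : ℝ)
    (p : EuclideanSpace ℝ (Fin m) × EuclideanSpace ℝ (Fin n)) : ℝ :=
  maxFun f Y p.1 + c * ‖p.2 - maximizer f Y p.1‖ ^ 2

/-- The step of gradient descent ascent from `p` along the gradient estimate `v`. -/
def gdaStep (Y : Set (EuclideanSpace ℝ (Fin n))) (ηx ηy : ℝ)
    (p : EuclideanSpace ℝ (Fin m) × EuclideanSpace ℝ (Fin n)) (v : JointSpace m n) :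
    EuclideanSpace ℝ (Fin m) × EuclideanSpace ℝ (Fin n) :=
  (p.1 - ηx • v.fst, proj Y (p.2 + ηy • v.snd))

/-- Young's inequality for the square of a sum, in the weighting used to track a moving target. -/
theorem norm_sub_sq_le_of_young {F : Type*} [NormedAddCommGroup F] [InnerProductSpace ℝ F]
    {β : ℝ} (hβ : 0 < β) (a b c : F) :
    ‖a - c‖ ^ 2 ≤ (1 + β) * ‖a - b‖ ^ 2 + (1 + 1 / β) * ‖b - c‖ ^ 2 := by
  have h1 : ‖a - c‖ ≤ ‖a - b‖ + ‖b - c‖ := norm_sub_le_norm_sub_add_norm_sub a b c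
  have h2 : ‖a - c‖ ^ 2 ≤ (‖a - b‖ + ‖b - c‖) ^ 2 := pow_le_pow_left₀ (norm_nonneg _) h1 2
  have h3 : 0 ≤ 1 / β * (β * ‖a - b‖ - ‖b - c‖) ^ 2 := by positivity
  have h4 : 1 / β * (β * ‖a - b‖ - ‖b - c‖) ^ 2 =
      β * ‖a - b‖ ^ 2 - 2 * ‖a - b‖ * ‖b - c‖ + 1 / β * ‖b - c‖ ^ 2 := by
    field_simp; ring
  nlinarith

/-- A noisy ascent step in `y`, with noise `ζ`; `u` is `2 / ℓ` times the difference of the noiseless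
steps from `y` and from the maximizer. -/
theorem NonconvexStronglyConcave.ascent_step (hf : NonconvexStronglyConcave f Y ℓ μ) (hn : 1 ≤ n)
    (x : EuclideanSpace ℝ (Fin m)) (y : EuclideanSpace ℝ (Fin n)) :
    ∃ u : EuclideanSpace ℝ (Fin n), ∀ ζ : EuclideanSpace ℝ (Fin n),
      ‖proj Y (y + (1 / ℓ) • ((∇ f (joint x y)).snd + ζ)) - maximizer f Y x‖ ^ 2 ≤
        (1 - μ / ℓ) * ‖y - maximizer f Y x‖ ^ 2 + inner ℝ u ζ + 1 / ℓ ^ 2 * ‖ζ‖ ^ 2 := by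
  have hℓ := hf.ell_pos hn
  set p := maximizer f Y x with hp
  have hu : ∀ w ∈ Y, inner ℝ (p + (1 / ℓ) • (∇ f (joint x p)).snd - p) (w - p) ≤ 0 := by
    intro w hw
    rw [add_sub_cancel_left, real_inner_smul_left]
    exact mul_nonpos_of_nonneg_of_nonpos (by positivity) (hf.inner_gradient_maximizer_le hn x hw)
  set a := y + (1 / ℓ) • (∇ f (joint x y)).snd with ha
  set b := p + (1 / ℓ) • (∇ f (joint x p)).snd with hb
  have hab : ‖a - b‖ ^ 2 ≤ (1 - μ / ℓ) * ‖y - p‖ ^ 2 :=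
    norm_ascent_step_sub_sq_le (φ := fun y => f (joint x y)) (g := fun y => (∇ f (joint x y)).snd)
      hf.mu_pos hℓ (hf.le_add_inner_sub x) (hf.partial_lower x) y p
  refine ⟨(2 / ℓ) • (a - b), fun ζ => ?_⟩
  have h1 := norm_proj_sub_le hf.nonempty hf.closed hf.convex (hf.maximizer_spec x).1 hu
    (y + (1 / ℓ) • ((∇ f (joint x y)).snd + ζ))
  have e : y + (1 / ℓ) • ((∇ f (joint x y)).snd + ζ) - b = (a - b) + (1 / ℓ) • ζ := by
    rw [ha, smul_add]; abel
  rw [e] at h1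
  have h2 := pow_le_pow_left₀ (norm_nonneg _) h1 2
  rw [norm_add_sq_real, inner_smul_right, norm_smul, mul_pow,
    Real.norm_of_nonneg (by positivity)] at h2
  rw [real_inner_smul_left]
  have e2 : (1 / ℓ) ^ 2 = 1 / ℓ ^ 2 := by ring
  have e3 : 2 * (1 / ℓ * inner ℝ (a - b) ζ) = 2 / ℓ * inner ℝ (a - b) ζ := by ring
  rw [e2, e3] at h2
  linarith

/-- With the step size `a` of the theorem, a step of length `a * ‖h‖` raises the potential, through
its curvature, by at most `a / 2 * ‖h‖ ^ 2`. -/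
theorem curvature_coefficient_le {ℓ κ a : ℝ} (hℓ : 0 < ℓ) (hκ : 1 ≤ κ)
    (ha : a = 1 / (16 * (κ + 1) ^ 2 * ℓ)) :
    ℓ * (κ + 1 / 2) * a ^ 2 + a * κ * ℓ ^ 2 * (1 + 2 * κ) * κ ^ 2 * a ^ 2 ≤ a / 2 := by
  have hκ0 : 0 < κ := by linarith
  have ha0 : 0 < a := by rw [ha]; positivity
  have e1 : ℓ * a * (16 * (κ + 1) ^ 2) = 1 := by rw [ha]; field_simp
  set s := ℓ * a with hs
  have hs0 : 0 < s := by positivity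
  have e2 : ℓ * (κ + 1 / 2) * a ^ 2 + a * κ * ℓ ^ 2 * (1 + 2 * κ) * κ ^ 2 * a ^ 2 =
      a * (s * (κ + 1 / 2) + s ^ 2 * (κ ^ 3 * (1 + 2 * κ))) := by rw [hs]; ring
  have h1 : s * (κ + 1 / 2) ≤ 1 / 16 := by 
    nlinarith [mul_pos hs0 hκ0, mul_pos (mul_pos hs0 hκ0) hκ0]
  have h2 : s * κ ^ 2 ≤ 1 / 16 := by nlinarith [mul_pos hs0 hκ0]
  have h3 : s * (κ * (1 + 2 * κ)) ≤ 3 / 16 := by nlinarith [mul_pos hs0 hκ0]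
  have h4 : s ^ 2 * (κ ^ 3 * (1 + 2 * κ)) ≤ 1 / 16 * (3 / 16) := by
    have : s ^ 2 * (κ ^ 3 * (1 + 2 * κ)) = (s * κ ^ 2) * (s * (κ * (1 + 2 * κ))) := by ring
    rw [this]
    exact mul_le_mul h2 h3 (by positivity) (by norm_num)
  rw [e2]
  nlinarith

/-- The descent of the Lyapunov function in one step, for an arbitrary error `ζ` of the gradient
estimate. The term linear in `ζ` averages out for an unbiased estimate. -/
theorem NonconvexStronglyConcave.potential_step_le (hf : NonconvexStronglyConcave f Y ℓ μ)
    (hn : 1 ≤ n) {κ a : ℝ} (hκ : κ = ℓ / μ) (ha : a = 1 / (16 * (κ + 1) ^ 2 * ℓ))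
    (p : EuclideanSpace ℝ (Fin m) × EuclideanSpace ℝ (Fin n)) :
    ∃ w : JointSpace m n, ∀ ζ : JointSpace m n,
      potential f Y (a * κ * ℓ ^ 2) (gdaStep Y a (1 / ℓ) p (∇ f (joint p.1 p.2) + ζ)) ≤
        potential f Y (a * κ * ℓ ^ 2) p - a / 2 * ‖∇ (maxFun f Y) p.1‖ ^ 2 + inner ℝ w ζ
          + 3 / 2 * a * κ * ‖ζ‖ ^ 2 := by
  obtain ⟨x, y⟩ := p
  have hℓ := hf.ell_pos hn
  have hμ := hf.mu_pos
  have hκ1 : 1 ≤ κ := by rw [hκ, one_le_div hμ]; exact hf.mu_le hn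
  have hκ0 : 0 < κ := by linarith
  have ha0 : 0 < a := by rw [ha]; positivity
  obtain ⟨u, hu⟩ := hf.ascent_step hn x y
  have hμκ : μ / ℓ = 1 / κ := by rw [hκ, one_div_div]
  simp only [potential, gdaStep]
  rw [hf.gradient_maxFun hn]
  set q := maximizer f Y x with hq
  set g := (∇ f (joint x q)).fst with hg
  set h := (∇ f (joint x y)).fst with hh
  set δ := ‖y - q‖ ^ 2 with hδ
  have hδ0 : 0 ≤ δ := by positivity
  have hgh : ‖g - h‖ ^ 2 ≤ ℓ ^ 2 * δ := by
    have h1 : ‖g - h‖ ≤ ‖∇ f (joint x q) - ∇ f (joint x y)‖ :=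
      norm_joint_fst_le (∇ f (joint x q) - ∇ f (joint x y))
    have h2 := hf.smooth.2 (joint x q) (joint x y)
    have h3 := pow_le_pow_left₀ (norm_nonneg _) (h1.trans h2) 2
    rw [mul_pow, norm_joint_sub_sq, sub_self, norm_zero, zero_pow two_ne_zero, zero_add,
      norm_sub_rev q y] at h3
    exact h3
  -- the coefficient of `‖x' - x‖² / a²` in the bound for the new value of the potential
  set B := ℓ * (κ + 1 / 2) * a ^ 2 + a * κ * ℓ ^ 2 * (1 + 2 * κ) * κ ^ 2 * a ^ 2 with hB
  have hBa : B ≤ a / 2 := curvature_coefficient_le hℓ hκ1 ha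
  have haκ : a ≤ a * κ := le_mul_of_one_le_right ha0.le hκ1
  refine ⟨joint ((2 * B) • h - a • g) ((a * κ * ℓ ^ 2 * (1 + 1 / (2 * κ))) • u), fun ζ => ?_⟩
  have hw : inner ℝ (joint ((2 * B) • h - a • g)
      ((a * κ * ℓ ^ 2 * (1 + 1 / (2 * κ))) • u)) ζ = 2 * B * inner ℝ h ζ.fst
        - a * inner ℝ g ζ.fst + a * κ * ℓ ^ 2 * (1 + 1 / (2 * κ)) * inner ℝ u ζ.snd := by
    rw [WithLp.prod_inner_apply]
    change inner ℝ ((2 * B) • h - a • g) ζ.fst + inner ℝ (_ • u) ζ.snd = _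
    rw [inner_sub_left, real_inner_smul_left, real_inner_smul_left, real_inner_smul_left]
  have hζ : ‖ζ‖ ^ 2 = ‖ζ.fst‖ ^ 2 + ‖ζ.snd‖ ^ 2 := WithLp.prod_norm_sq_eq_of_L2 ζ
  rw [hw, hζ]
  set x' := x - a • (∇ f (joint x y) + ζ).fst with hx'
  set y' := proj Y (y + (1 / ℓ) • (∇ f (joint x y) + ζ).snd) with hy'
  have hxx : x' - x = -(a • (h + ζ.fst)) := by
    rw [hx', sub_sub_cancel_left, WithLp.add_fst]
  have hΦ := hf.maxFun_upper hn x x'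
  rw [← hκ, ← hq, ← hg, hxx, inner_neg_right, inner_smul_right, inner_add_right, norm_neg, norm_smul,
    mul_pow, Real.norm_of_nonneg ha0.le, norm_add_sq_real] at hΦ
  have hy := hu ζ.snd
  rw [← WithLp.add_snd, ← hy', hμκ] at hy
  -- `β = 1 / (2 * κ)` gives away half of the contraction `1 - 1 / κ` to the motion of the maximizer
  have hyoung := norm_sub_sq_le_of_young (β := 1 / (2 * κ)) (by positivity) y' q (maximizer f Y x')
  have hlip : ‖q - maximizer f Y x'‖ ^ 2
      ≤ κ ^ 2 * (a ^ 2 * (‖h‖ ^ 2 + 2 * inner ℝ h ζ.fst + ‖ζ.fst‖ ^ 2)) := by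
    have h1 := pow_le_pow_left₀ (norm_nonneg _) (hf.norm_maximizer_sub_le hn x x') 2
    rwa [norm_sub_rev x x', hxx, norm_neg, norm_smul, Real.norm_of_nonneg ha0.le, mul_pow, mul_pow,
      norm_add_sq_real, ← hκ] at h1
  have hinner := norm_sub_sq_real g h
  rw [one_div_one_div] at hyoung
  set c := a * κ * ℓ ^ 2 with hc
  have hc0 : 0 < c := by positivity
  set β := 1 / (2 * κ) with hβ
  have hβ0 : 0 < β := by positivity
  have hc1 := mul_le_mul_of_nonneg_left hyoung hc0.le
  have hc2 := mul_le_mul_of_nonneg_left hy (mul_pos hc0 (by linarith : 0 < 1 + β)).le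
  have hc3 := mul_le_mul_of_nonneg_left hlip (mul_pos hc0 (by linarith : 0 < 1 + 2 * κ)).le
  -- the weight `c` is such that the contraction pays for the gradient mismatch `‖g - h‖²`
  have hcδ : c * (1 + β) * ((1 - 1 / κ) * δ) ≤ c * δ - a / 2 * (ℓ ^ 2 * δ) := by
    have h1 : c * (1 + β) * ((1 - 1 / κ) * δ) =
        c * δ - a / 2 * (ℓ ^ 2 * δ) - a * ℓ ^ 2 * δ / (2 * κ) := by
      rw [hc, hβ]; field_simp; ring
    have h2 : 0 ≤ a * ℓ ^ 2 * δ / (2 * κ) := by positivity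
    linarith
  have hcζ : c * (1 + β) * (1 / ℓ ^ 2 * ‖ζ.snd‖ ^ 2) ≤ 3 / 2 * a * κ * ‖ζ.snd‖ ^ 2 := by
    have h1 : c * (1 + β) * (1 / ℓ ^ 2 * ‖ζ.snd‖ ^ 2) = a * (κ + 1 / 2) * ‖ζ.snd‖ ^ 2 := by
      rw [hc, hβ]; field_simp
    rw [h1]
    exact mul_le_mul_of_nonneg_right (by linarith) (by positivity)
  have hBζ : B * ‖ζ.fst‖ ^ 2 ≤ 3 / 2 * a * κ * ‖ζ.fst‖ ^ 2 :=
    mul_le_mul_of_nonneg_right (by linarith) (by positivity)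
  have hBh : B * ‖h‖ ^ 2 ≤ a / 2 * ‖h‖ ^ 2 := mul_le_mul_of_nonneg_right hBa (by positivity)
  have hga := mul_le_mul_of_nonneg_left hgh (by positivity : 0 ≤ a / 2)
  rw [hinner] at hga
  have hBexp : ∀ r : ℝ, ℓ * (κ + 1 / 2) * (a ^ 2 * r) + c * (1 + 2 * κ) * (κ ^ 2 * (a ^ 2 * r))
      = B * r := fun r => by rw [hB]; ring
  have hBr := hBexp (‖h‖ ^ 2 + 2 * inner ℝ h ζ.fst + ‖ζ.fst‖ ^ 2)
  linarith

end OneStep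

/-! ### Variance of the minibatch gradient -/

section Minibatch

theorem MeasureTheory.MemLp.integrable_inner_of_two {Ω E : Type*} [MeasurableSpace Ω]
    {P : Measure Ω} [NormedAddCommGroup E] [InnerProductSpace ℝ E] {X Z : Ω → E}
    (hX : MemLp X 2 P) (hZ : MemLp Z 2 P) : Integrable (fun ω => inner ℝ (X ω) (Z ω)) P := by
  refine (hX.norm.integrable_mul hZ.norm).mono
    (hX.aestronglyMeasurable.inner hZ.aestronglyMeasurable) (Filter.Eventually.of_forall fun ω => ?_)
  simpa using abs_real_inner_le_norm (X ω) (Z ω)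

/-- The variance of a sum of independent centred random vectors is the sum of their variances. -/
theorem integral_norm_sum_sq_of_iIndepFun {Ω E ι : Type*} [MeasurableSpace Ω] {P : Measure Ω}
    [IsProbabilityMeasure P] [Fintype ι] [NormedAddCommGroup E] [InnerProductSpace ℝ E]
    [CompleteSpace E] [MeasurableSpace E] [BorelSpace E] {X : ι → Ω → E}
    (hX : ∀ i, MemLp (X i) 2 P) (hind : iIndepFun X P) (h0 : ∀ i, ∫ ω, X i ω ∂P = 0) :
    ∫ ω, ‖∑ i, X i ω‖ ^ 2 ∂P = ∑ i, ∫ ω, ‖X i ω‖ ^ 2 ∂P := by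
  have e : ∀ ω, ‖∑ i, X i ω‖ ^ 2 = ∑ i, ∑ j, inner ℝ (X i ω) (X j ω) := fun ω => by
    rw [← real_inner_self_eq_norm_sq, sum_inner]
    exact Finset.sum_congr rfl fun i _ => inner_sum _ _ _
  have hint : ∀ i j, Integrable (fun ω => inner ℝ (X i ω) (X j ω)) P :=
    fun i j => (hX i).integrable_inner_of_two (hX j)
  simp_rw [e]
  rw [integral_finsetSum _ fun i _ => integrable_finsetSum _ fun j _ => hint i j]
  refine Finset.sum_congr rfl fun i _ => ?_
  rw [integral_finsetSum _ fun j _ => hint i j, Finset.sum_eq_single i]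
  · simp_rw [real_inner_self_eq_norm_sq]
  · intro j _ hji
    have h := (hind.indepFun hji.symm).integral_bilin ((hX i).integrable (by norm_num))
      ((hX j).integrable (by norm_num)) (innerSL ℝ)
    rw [h0 i, h0 j, map_zero] at h
    exact h
  · simp

variable {m n M : ℕ} {Ξ : Type*}

/-- The average of the stochastic gradients over a minibatch. -/
def minibatchGradient (G : JointSpace m n → Ξ → JointSpace m n) (z : JointSpace m n)
    (s : Fin M → Ξ) : JointSpace m n :=
  (1 / (M : ℝ)) • ∑ i, G z (s i)

theorem minibatchGradient_sub {G : JointSpace m n → Ξ → JointSpace m n} (hM : 1 ≤ M)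
    (z v : JointSpace m n) (s : Fin M → Ξ) :
    minibatchGradient G z s - v = (1 / (M : ℝ)) • ∑ i, (G z (s i) - v) := by
  have hM0 : (M : ℝ) ≠ 0 := by positivity
  rw [minibatchGradient, Finset.sum_sub_distrib, smul_sub, Finset.sum_const, Finset.card_univ,
    Fintype.card_fin, ← Nat.cast_smul_eq_nsmul ℝ, smul_smul, one_div, inv_mul_cancel₀ hM0, one_smul]

variable [MeasurableSpace Ξ] {ν : Measure Ξ} [IsProbabilityMeasure ν] {f : JointSpace m n → ℝ}
  {G : JointSpace m n → Ξ → JointSpace m n} {σ : ℝ}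

theorem IsStochasticOracle.memLp_eval_sub (hG : IsStochasticOracle ν f G σ) (z : JointSpace m n)
    (i : Fin M) :
    MemLp (fun s : Fin M → Ξ => G z (s i) - ∇ f z) 2 (Measure.pi fun _ => ν) :=
  ((hG.memLp z).sub (memLp_const (∇ f z))).comp_measurePreserving
    (measurePreserving_eval (fun _ : Fin M => ν) i)

theorem IsStochasticOracle.memLp_minibatchGradient_sub (hG : IsStochasticOracle ν f G σ)
    (hM : 1 ≤ M) (z : JointSpace m n) :
    MemLp (fun s : Fin M → Ξ => minibatchGradient G z s - ∇ f z) 2 (Measure.pi fun _ => ν) := by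
  simp_rw [minibatchGradient_sub hM]
  exact (memLp_finsetSum _ fun i _ => hG.memLp_eval_sub z i).const_smul (1 / (M : ℝ))

theorem IsStochasticOracle.integral_eval_sub (hG : IsStochasticOracle ν f G σ) (z : JointSpace m n)
    (i : Fin M) :
    ∫ s : Fin M → Ξ, (G z (s i) - ∇ f z) ∂(Measure.pi fun _ => ν) = 0 := by
  rw [integral_comp_eval (μ := fun _ : Fin M => ν) (i := i) (f := fun s => G z s - ∇ f z)]
  · exact hG.unbiased z
  · exact ((hG.memLp z).sub (memLp_const (∇ f z))).aestronglyMeasurable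

theorem IsStochasticOracle.integral_minibatchGradient_sub (hG : IsStochasticOracle ν f G σ)
    (hM : 1 ≤ M) (z : JointSpace m n) :
    ∫ s : Fin M → Ξ, (minibatchGradient G z s - ∇ f z) ∂(Measure.pi fun _ => ν) = 0 := by
  simp_rw [minibatchGradient_sub hM]
  rw [integral_smul, integral_finsetSum _ fun i _ =>
    (hG.memLp_eval_sub z i).integrable (by norm_num)]
  simp [hG.integral_eval_sub z]

theorem IsStochasticOracle.integral_norm_minibatchGradient_sub_sq_le
    (hG : IsStochasticOracle ν f G σ) (hM : 1 ≤ M) (z : JointSpace m n) :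
    ∫ s : Fin M → Ξ, ‖minibatchGradient G z s - ∇ f z‖ ^ 2 ∂(Measure.pi fun _ => ν)
      ≤ σ ^ 2 / M := by
  have hM0 : (0 : ℝ) < M := by positivity
  have hmeas : AEStronglyMeasurable (fun s => G z s - ∇ f z) ν :=
    ((hG.memLp z).sub (memLp_const (∇ f z))).aestronglyMeasurable
  have hind : iIndepFun (fun (i : Fin M) (s : Fin M → Ξ) => G z (s i) - ∇ f z)
      (Measure.pi fun _ => ν) :=
    iIndepFun_pi (X := fun _ s => G z s - ∇ f z) fun _ => hmeas.aemeasurable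
  have hsum := integral_norm_sum_sq_of_iIndepFun (fun i => hG.memLp_eval_sub z i) hind
    (hG.integral_eval_sub z)
  simp_rw [minibatchGradient_sub hM, norm_smul, mul_pow]
  rw [integral_const_mul, hsum]
  have hle : ∑ i : Fin M, ∫ s : Fin M → Ξ, ‖G z (s i) - ∇ f z‖ ^ 2 ∂(Measure.pi fun _ => ν)
      ≤ ∑ i : Fin M, σ ^ 2 := by
    refine Finset.sum_le_sum fun i _ => ?_
    rw [integral_comp_eval (μ := fun _ : Fin M => ν) (i := i) (f := fun s => ‖G z s - ∇ f z‖ ^ 2)]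
    · exact hG.variance_le z
    · exact hmeas.norm.pow 2
  rw [Finset.sum_const, Finset.card_univ, Fintype.card_fin, nsmul_eq_mul] at hle
  rw [Real.norm_of_nonneg (by positivity)]
  refine (mul_le_mul_of_nonneg_left hle (by positivity)).trans_eq ?_
  field_simp

end Minibatch

/-! ### Expected descent in one step -/

section ExpectedStep

variable {m n M : ℕ} {Ξ : Type*} [MeasurableSpace Ξ] {ν : Measure Ξ} [IsProbabilityMeasure ν]
  {f : JointSpace m n → ℝ} {Y : Set (EuclideanSpace ℝ (Fin n))} {ℓ μ : ℝ}
  {G : JointSpace m n → Ξ → JointSpace m n} {σ : ℝ}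

/-- The nonnegative Lyapunov function `Φ(x) - inf Φ + c * ‖y - y*(x)‖²`. -/
def potentialGap (f : JointSpace m n → ℝ) (Y : Set (EuclideanSpace ℝ (Fin n))) (c : ℝ)
    (p : EuclideanSpace ℝ (Fin m) × EuclideanSpace ℝ (Fin n)) : ℝ :=
  potential f Y c p - ⨅ x, maxFun f Y x

theorem potentialGap_nonneg (hb : BddBelow (Set.range (maxFun f Y))) {c : ℝ} (hc : 0 ≤ c)
    (p : EuclideanSpace ℝ (Fin m) × EuclideanSpace ℝ (Fin n)) : 0 ≤ potentialGap f Y c p := by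
  have h1 := ciInf_le hb p.1
  have h2 : 0 ≤ c * ‖p.2 - maximizer f Y p.1‖ ^ 2 := by positivity
  rw [potentialGap, potential]
  linarith

/-- The expected descent of the Lyapunov function in one step from a fixed state. -/
theorem lintegral_potentialGap_step_le (hf : NonconvexStronglyConcave f Y ℓ μ) (hn : 1 ≤ n)
    (hb : BddBelow (Set.range (maxFun f Y))) (hG : IsStochasticOracle ν f G σ) (hM : 1 ≤ M)
    {κ a : ℝ} (hκ : κ = ℓ / μ) (ha : a = 1 / (16 * (κ + 1) ^ 2 * ℓ))
    (p : EuclideanSpace ℝ (Fin m) × EuclideanSpace ℝ (Fin n)) :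
    (∫⁻ s : Fin M → Ξ, ENNReal.ofReal (potentialGap f Y (a * κ * ℓ ^ 2)
        (gdaStep Y a (1 / ℓ) p (minibatchGradient G (joint p.1 p.2) s))) ∂(Measure.pi fun _ => ν))
      + ENNReal.ofReal (a / 2 * ‖∇ (maxFun f Y) p.1‖ ^ 2) ≤
    ENNReal.ofReal (potentialGap f Y (a * κ * ℓ ^ 2) p)
      + ENNReal.ofReal (3 / 2 * a * κ * (σ ^ 2 / M)) := by
  have hℓ := hf.ell_pos hn
  have hκ0 : 0 < κ := by rw [hκ]; exact div_pos hℓ hf.mu_pos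
  have ha0 : 0 < a := by rw [ha]; positivity
  have hc0 : 0 ≤ a * κ * ℓ ^ 2 := by positivity
  obtain ⟨w, hw⟩ := hf.potential_step_le hn hκ ha p
  set z := joint p.1 p.2 with hz
  set c := a * κ * ℓ ^ 2 with hc
  set A := potentialGap f Y c p - a / 2 * ‖∇ (maxFun f Y) p.1‖ ^ 2 with hA
  set ζ : (Fin M → Ξ) → JointSpace m n := fun s => minibatchGradient G z s - ∇ f z with hζ
  have hζL : MemLp ζ 2 (Measure.pi fun _ => ν) := hG.memLp_minibatchGradient_sub hM z
  have hle : ∀ s : Fin M → Ξ, potentialGap f Y c (gdaStep Y a (1 / ℓ) p (minibatchGradient G z s))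
      ≤ A + inner ℝ w (ζ s) + 3 / 2 * a * κ * ‖ζ s‖ ^ 2 := fun s => by
    have h := hw (ζ s)
    rw [hζ, add_sub_cancel] at h
    simp only [hA, potentialGap]
    linarith
  have hint1 : Integrable (fun s => inner ℝ w (ζ s)) (Measure.pi fun _ => ν) :=
    (hζL.integrable (by norm_num)).const_inner w
  have hint2 : Integrable (fun s => 3 / 2 * a * κ * ‖ζ s‖ ^ 2) (Measure.pi fun _ => ν) :=
    (hζL.integrable_norm_pow two_ne_zero).const_mul _
  have hint12 : Integrable (fun s => A + inner ℝ w (ζ s)) (Measure.pi fun _ => ν) :=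
    (integrable_const A).add hint1
  have hint : Integrable (fun s => A + inner ℝ w (ζ s) + 3 / 2 * a * κ * ‖ζ s‖ ^ 2)
      (Measure.pi fun _ => ν) := hint12.add hint2
  have hnn := fun s => (potentialGap_nonneg hb hc0
    (gdaStep Y a (1 / ℓ) p (minibatchGradient G z s))).trans (hle s)
  have hI : ∫ s, (A + inner ℝ w (ζ s) + 3 / 2 * a * κ * ‖ζ s‖ ^ 2) ∂(Measure.pi fun _ => ν)
      ≤ A + 3 / 2 * a * κ * (σ ^ 2 / M) := by
    rw [integral_add hint12 hint2,
      integral_add (integrable_const A) hint1, integral_const_mul,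
      integral_inner (hζL.integrable (by norm_num)), hG.integral_minibatchGradient_sub hM z]
    simp only [integral_const, probReal_univ, one_smul, inner_zero_right, add_zero]
    gcongr
    exact hG.integral_norm_minibatchGradient_sub_sq_le hM z
  calc _ ≤ ENNReal.ofReal (∫ s, (A + inner ℝ w (ζ s) + 3 / 2 * a * κ * ‖ζ s‖ ^ 2)
          ∂(Measure.pi fun _ => ν)) + ENNReal.ofReal (a / 2 * ‖∇ (maxFun f Y) p.1‖ ^ 2) := by
        rw [ofReal_integral_eq_lintegral_ofReal hint (Filter.Eventually.of_forall hnn)]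
        gcongr with s
        exact hle s
    _ = ENNReal.ofReal (∫ s, (A + inner ℝ w (ζ s) + 3 / 2 * a * κ * ‖ζ s‖ ^ 2)
          ∂(Measure.pi fun _ => ν) + a / 2 * ‖∇ (maxFun f Y) p.1‖ ^ 2) :=
        (ENNReal.ofReal_add (integral_nonneg hnn) (by positivity)).symm
    _ ≤ ENNReal.ofReal (potentialGap f Y c p + 3 / 2 * a * κ * (σ ^ 2 / M)) := by
        apply ENNReal.ofReal_le_ofReal
        linarith
    _ = _ := ENNReal.ofReal_add (potentialGap_nonneg hb hc0 p) (by positivity)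

end ExpectedStep

/-! ### The random iterates and the telescoped bound -/

section Iterates

variable {m n M : ℕ} {Ξ : Type*} {f : JointSpace m n → ℝ}
  {Y : Set (EuclideanSpace ℝ (Fin n))} {ℓ μ σ a b : ℝ}
  {G : JointSpace m n → Ξ → JointSpace m n}
  {x₀ : EuclideanSpace ℝ (Fin m)} {y₀ : EuclideanSpace ℝ (Fin n)}

/-- The iterates `(x_t, y_t)` of SGDA along the data path `s`. -/
def iterate (G : JointSpace m n → Ξ → JointSpace m n)
    (Y : Set (EuclideanSpace ℝ (Fin n))) (ηx ηy : ℝ)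
    (x₀ : EuclideanSpace ℝ (Fin m)) (y₀ : EuclideanSpace ℝ (Fin n))
    (s : ℕ → Fin M → Ξ) (t : ℕ) : EuclideanSpace ℝ (Fin m) × EuclideanSpace ℝ (Fin n) :=
  ((sgda G Y ηx ηy x₀ y₀ s t).x, (sgda G Y ηx ηy x₀ y₀ s t).y)

theorem joint_fst_sum {ι : Type*} (v : ι → JointSpace m n) (S : Finset ι) :
    (∑ i ∈ S, v i).fst = ∑ i ∈ S, (v i).fst := by
  change (WithLp.ofLp (∑ i ∈ S, v i)).1 = _
  rw [WithLp.ofLp_sum, Prod.fst_sum]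
  rfl

theorem joint_snd_sum {ι : Type*} (v : ι → JointSpace m n) (S : Finset ι) :
    (∑ i ∈ S, v i).snd = ∑ i ∈ S, (v i).snd := by
  change (WithLp.ofLp (∑ i ∈ S, v i)).2 = _
  rw [WithLp.ofLp_sum, Prod.snd_sum]
  rfl

theorem iterate_succ (s : ℕ → Fin M → Ξ) (t : ℕ) :
    iterate G Y a b x₀ y₀ s (t + 1) = gdaStep Y a b (iterate G Y a b x₀ y₀ s t)
      (minibatchGradient G (joint (iterate G Y a b x₀ y₀ s t).1 (iterate G Y a b x₀ y₀ s t).2)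
        (s t)) := by
  simp [iterate, gdaStep, minibatchGradient, sgda, sgdaStep, oracleQuery, joint_fst_sum,
    joint_snd_sum]

theorem sgda_calls (s : ℕ → Fin M → Ξ) (t : ℕ) :
    (sgda G Y a b x₀ y₀ s t).calls = t * M := by
  induction t with
  | zero => simp [sgda]
  | succ t ih => simp [sgda, sgdaStep, oracleQuery, ih, Nat.succ_mul]

variable [MeasurableSpace Ξ]

theorem measurable_step (hf : NonconvexStronglyConcave f Y ℓ μ)
    (hG : Measurable (Function.uncurry G)) :
    Measurable fun q : (EuclideanSpace ℝ (Fin m) × EuclideanSpace ℝ (Fin n)) × (Fin M → Ξ) =>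
      gdaStep Y a b q.1 (minibatchGradient G (joint q.1.1 q.1.2) q.2) := by
  have hj : Measurable fun q : (EuclideanSpace ℝ (Fin m) × EuclideanSpace ℝ (Fin n))
      × (Fin M → Ξ) => joint q.1.1 q.1.2 := continuous_joint.measurable.comp measurable_fst
  have hmb : Measurable fun q : (EuclideanSpace ℝ (Fin m) × EuclideanSpace ℝ (Fin n))
      × (Fin M → Ξ) => minibatchGradient G (joint q.1.1 q.1.2) q.2 := by
    have hsum : Measurable fun q : (EuclideanSpace ℝ (Fin m) × EuclideanSpace ℝ (Fin n))
        × (Fin M → Ξ) => ∑ i, G (joint q.1.1 q.1.2) (q.2 i) :=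
      Finset.measurable_sum _ fun i _ =>
        hG.comp (hj.prodMk ((measurable_pi_apply i).comp measurable_snd))
    exact hsum.const_smul (1 / (M : ℝ))
  have hofLp : Measurable (WithLp.ofLp : JointSpace m n → _) :=
    (WithLp.prod_continuous_ofLp 2 _ _).measurable
  have hproj : Measurable (proj Y) :=
    (continuous_proj hf.nonempty hf.closed hf.convex).measurable
  refine Measurable.prodMk ?_ (hproj.comp ?_)
  · exact (measurable_fst.comp measurable_fst).sub
      ((measurable_fst.comp (hofLp.comp hmb)).const_smul a)
  · exact (measurable_snd.comp measurable_fst).add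
      ((measurable_snd.comp (hofLp.comp hmb)).const_smul b)

theorem measurable_iterate (hf : NonconvexStronglyConcave f Y ℓ μ)
    (hG : Measurable (Function.uncurry G)) (t : ℕ) :
    Measurable fun s : ℕ → Fin M → Ξ => iterate G Y a b x₀ y₀ s t := by
  induction t with
  | zero =>
    simp only [iterate, sgda]
    exact measurable_const
  | succ t ih =>
    simp_rw [iterate_succ]
    exact (measurable_step hf hG).comp (ih.prodMk (measurable_pi_apply t))

variable {Ω : Type*}

/-- The iterates up to time `t` depend only on the data of the iterations before `t`. -/
theorem measurable_iterate_past (hf : NonconvexStronglyConcave f Y ℓ μ)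
    (hG : Measurable (Function.uncurry G)) (ξ : ℕ → Fin M → Ω → Ξ) (t : ℕ) :
    Measurable[⨆ p ∈ {p : ℕ × Fin M | p.1 < t}, MeasurableSpace.comap (ξ p.1 p.2) inferInstance]
      fun ω => iterate G Y a b x₀ y₀ (fun t i => ξ t i ω) t := by
  induction t with
  | zero =>
    simp only [iterate, sgda]
    exact measurable_const
  | succ t ih =>
    simp_rw [iterate_succ]
    refine (measurable_step hf hG).comp (Measurable.prodMk (ih.mono ?_ le_rfl) ?_)
    · exact biSup_mono fun p (hp : p.1 < t) => (hp.trans (Nat.lt_succ_self t) : p.1 < t + 1)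
    · refine (@measurable_pi_iff _ _ _ (_) _ _).2 fun i => measurable_iff_comap_le.2 ?_
      exact le_biSup (fun p : ℕ × Fin M => MeasurableSpace.comap (ξ p.1 p.2) inferInstance)
        (show (t, i) ∈ {p : ℕ × Fin M | p.1 < t + 1} from Nat.lt_succ_self t)

variable [MeasurableSpace Ω] {P : Measure Ω} {ν : Measure Ξ}
  {ξ : ℕ → Fin M → Ω → Ξ}

theorem IsIIDSample.map_batch [IsProbabilityMeasure P] (hξ : IsIIDSample P ν ξ) (t : ℕ) :
    P.map (fun ω i => ξ t i ω) = Measure.pi fun _ => ν := by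
  have h : iIndepFun (fun i => ξ t i) P :=
    hξ.indep.precomp (g := fun i : Fin M => (t, i)) fun i j hij => (Prod.mk.inj hij).2
  rw [(iIndepFun_iff_map_fun_eq_pi_map fun i => (hξ.measurable t i).aemeasurable).1 h]
  simp_rw [hξ.law]

theorem IsIIDSample.measurable_batch (hξ : IsIIDSample P ν ξ) (t : ℕ) :
    Measurable fun ω i => ξ t i ω :=
  measurable_pi_iff.2 fun i => hξ.measurable t i

theorem IsIIDSample.measurable_path (hξ : IsIIDSample P ν ξ) :
    Measurable fun ω t i => ξ t i ω :=
  measurable_pi_iff.2 fun t => hξ.measurable_batch t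

theorem IsIIDSample.indepFun_iterate_batch (hξ : IsIIDSample P ν ξ)
    (hf : NonconvexStronglyConcave f Y ℓ μ) (hG : Measurable (Function.uncurry G)) (t : ℕ) :
    IndepFun (fun ω => iterate G Y a b x₀ y₀ (fun t i => ξ t i ω) t) (fun ω i => ξ t i ω) P := by
  have hdisj : Disjoint {p : ℕ × Fin M | p.1 < t} {p : ℕ × Fin M | p.1 = t} :=
    Set.disjoint_left.2 fun p (h1 : p.1 < t) (h2 : p.1 = t) => h1.ne h2
  have h := indep_iSup_of_disjoint (fun p => (hξ.measurable p.1 p.2).comap_le) hξ.indep.iIndep hdisj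
  have hbatch : Measurable[⨆ p ∈ {p : ℕ × Fin M | p.1 = t},
      MeasurableSpace.comap (ξ p.1 p.2) inferInstance] fun ω i => ξ t i ω := by
    refine (@measurable_pi_iff _ _ _ (_) _ _).2 fun i => measurable_iff_comap_le.2 ?_
    exact le_biSup (fun p : ℕ × Fin M => MeasurableSpace.comap (ξ p.1 p.2) inferInstance)
      (show (t, i) ∈ {p : ℕ × Fin M | p.1 = t} from rfl)
  exact indep_of_indep_of_le_left
    (indep_of_indep_of_le_right h (measurable_iff_comap_le.1 hbatch))
    (measurable_iff_comap_le.1 (measurable_iterate_past hf hG ξ t))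

/-- Freshness of the minibatch: an expectation over the next state can be taken first over the
minibatch, then over the current state. -/
theorem IsIIDSample.lintegral_iterate_succ (hξ : IsIIDSample P ν ξ) [IsProbabilityMeasure P]
    [IsProbabilityMeasure ν]
    (hf : NonconvexStronglyConcave f Y ℓ μ) (hG : Measurable (Function.uncurry G))
    {W : EuclideanSpace ℝ (Fin m) × EuclideanSpace ℝ (Fin n) → ENNReal} (hW : Measurable W)
    (t : ℕ) :
    ∫⁻ ω, W (iterate G Y a b x₀ y₀ (fun t i => ξ t i ω) (t + 1)) ∂P =
      ∫⁻ ω, ∫⁻ s : Fin M → Ξ, W (gdaStep Y a b (iterate G Y a b x₀ y₀ (fun t i => ξ t i ω) t)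
        (minibatchGradient G (joint (iterate G Y a b x₀ y₀ (fun t i => ξ t i ω) t).1
          (iterate G Y a b x₀ y₀ (fun t i => ξ t i ω) t).2) s)) ∂(Measure.pi fun _ => ν) ∂P := by
  have hZ : Measurable fun ω => iterate G Y a b x₀ y₀ (fun t i => ξ t i ω) t :=
    (measurable_iterate hf hG t).comp hξ.measurable_path
  have hB := hξ.measurable_batch t
  have hstep : Measurable fun q : (EuclideanSpace ℝ (Fin m) × EuclideanSpace ℝ (Fin n))
      × (Fin M → Ξ) => W (gdaStep Y a b q.1 (minibatchGradient G (joint q.1.1 q.1.2) q.2)) :=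
    hW.comp (measurable_step hf hG)
  have hlaw := (indepFun_iff_map_prod_eq_prod_map_map hZ.aemeasurable hB.aemeasurable).1
    (hξ.indepFun_iterate_batch (a := a) (b := b) (x₀ := x₀) (y₀ := y₀) hf hG t)
  rw [hξ.map_batch t] at hlaw
  simp_rw [iterate_succ]
  rw [← lintegral_map (f := fun q : (EuclideanSpace ℝ (Fin m) × EuclideanSpace ℝ (Fin n))
      × (Fin M → Ξ) => W (gdaStep Y a b q.1 (minibatchGradient G (joint q.1.1 q.1.2) q.2)))
      hstep (hZ.prodMk hB), hlaw, lintegral_prod _ hstep.aemeasurable,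
    lintegral_map hstep.lintegral_prod_right' hZ]

theorem measurable_potentialGap (hf : NonconvexStronglyConcave f Y ℓ μ) (hn : 1 ≤ n) (c : ℝ) :
    Measurable (potentialGap f Y c) := by
  have h1 : Continuous (maxFun f Y) := (hf.differentiable_maxFun hn).continuous
  have h2 := hf.continuous_maximizer hn
  unfold potentialGap potential
  exact Continuous.measurable (by fun_prop)

/-- The bound on the accumulated squared gradients, by telescoping the Lyapunov function. -/
theorem sum_lintegral_gradient_sq_le (hf : NonconvexStronglyConcave f Y ℓ μ) (hn : 1 ≤ n)
    (hb : BddBelow (Set.range (maxFun f Y))) [IsProbabilityMeasure P] [IsProbabilityMeasure ν]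
    (hG : IsStochasticOracle ν f G σ) (hM : 1 ≤ M) (hξ : IsIIDSample P ν ξ)
    {κ : ℝ} (hκ : κ = ℓ / μ) (ha : a = 1 / (16 * (κ + 1) ^ 2 * ℓ)) (T : ℕ) :
    (∫⁻ ω, ENNReal.ofReal (potentialGap f Y (a * κ * ℓ ^ 2)
        (iterate G Y a (1 / ℓ) x₀ y₀ (fun t i => ξ t i ω) T)) ∂P)
      + ∑ t ∈ Finset.range T, ∫⁻ ω, ENNReal.ofReal (a / 2 *
        ‖∇ (maxFun f Y) (iterate G Y a (1 / ℓ) x₀ y₀ (fun t i => ξ t i ω) t).1‖ ^ 2) ∂P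
    ≤ ENNReal.ofReal (potentialGap f Y (a * κ * ℓ ^ 2) (x₀, y₀))
      + T * ENNReal.ofReal (3 / 2 * a * κ * (σ ^ 2 / M)) := by
  induction T with
  | zero => simp [iterate, sgda]
  | succ T ih =>
    have hW : Measurable fun p => ENNReal.ofReal (potentialGap f Y (a * κ * ℓ ^ 2) p) :=
      (measurable_potentialGap hf hn _).ennreal_ofReal
    have hZ : Measurable fun ω => iterate G Y a (1 / ℓ) x₀ y₀ (fun t i => ξ t i ω) T :=
      (measurable_iterate hf hG.measurable T).comp hξ.measurable_path
    have hg : Measurable fun ω => ENNReal.ofReal (a / 2 *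
        ‖∇ (maxFun f Y) (iterate G Y a (1 / ℓ) x₀ y₀ (fun t i => ξ t i ω) T).1‖ ^ 2) :=
      (((((hf.continuous_gradient_maxFun hn).measurable.comp
        (measurable_fst.comp hZ)).norm.pow_const 2).const_mul (a / 2))).ennreal_ofReal
    have hstep : (∫⁻ ω, ENNReal.ofReal (potentialGap f Y (a * κ * ℓ ^ 2)
          (iterate G Y a (1 / ℓ) x₀ y₀ (fun t i => ξ t i ω) (T + 1))) ∂P)
        + ∫⁻ ω, ENNReal.ofReal (a / 2 *
        ‖∇ (maxFun f Y) (iterate G Y a (1 / ℓ) x₀ y₀ (fun t i => ξ t i ω) T).1‖ ^ 2) ∂P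
        ≤ (∫⁻ ω, ENNReal.ofReal (potentialGap f Y (a * κ * ℓ ^ 2)
          (iterate G Y a (1 / ℓ) x₀ y₀ (fun t i => ξ t i ω) T)) ∂P)
          + ENNReal.ofReal (3 / 2 * a * κ * (σ ^ 2 / M)) := by
      rw [hξ.lintegral_iterate_succ hf hG.measurable hW, ← lintegral_add_right _ hg]
      refine (lintegral_mono fun ω =>
        lintegral_potentialGap_step_le hf hn hb hG hM hκ ha _).trans ?_
      rw [lintegral_add_right _ measurable_const, lintegral_const, measure_univ, mul_one]
    rw [Finset.sum_range_succ, Nat.cast_succ, add_mul, one_mul]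
    calc _ ≤ _ := le_of_eq (by ring)
      _ ≤ _ := add_le_add_left hstep (∑ t ∈ Finset.range T, ∫⁻ ω, ENNReal.ofReal (a / 2 *
        ‖∇ (maxFun f Y) (iterate G Y a (1 / ℓ) x₀ y₀ (fun t i => ξ t i ω) t).1‖ ^ 2) ∂P)
      _ ≤ _ := le_of_eq (by ring)
      _ ≤ _ := add_le_add_left ih (ENNReal.ofReal (3 / 2 * a * κ * (σ ^ 2 / M)))
      _ ≤ _ := le_of_eq (by ring)

end Iterates

/-! ### The uniformly drawn output index -/

section Draw

theorem lintegral_uniformOn_Icc (T : ℕ) (h : ℕ → ENNReal) :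
    ∫⁻ t, h t ∂(uniformOn (Set.Icc 1 T)) = (T : ENNReal)⁻¹ * ∑ t ∈ Finset.Icc 1 T, h t := by
  rw [uniformOn, ProbabilityTheory.cond, lintegral_smul_measure, ← Finset.coe_Icc,
    lintegral_finset, Measure.count_apply_finset, Nat.card_Icc]
  simp

/-- An expectation at an independent uniform time is the average of the expectations. -/
theorem IsUniformDraw.lintegral_eq {Ω Ξ : Type*} [MeasurableSpace Ω] [MeasurableSpace Ξ] {M : ℕ}
    {P : Measure Ω} [IsProbabilityMeasure P] {ξ : ℕ → Fin M → Ω → Ξ} {T : ℕ} {τ : Ω → ℕ}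
    (hτ : IsUniformDraw P ξ T τ) (hξ : Measurable fun ω t i => ξ t i ω)
    {h : ℕ → (ℕ → Fin M → Ξ) → ENNReal} (hh : ∀ t, Measurable (h t)) :
    ∫⁻ ω, h (τ ω) (fun t i => ξ t i ω) ∂P =
      (T : ENNReal)⁻¹ * ∑ t ∈ Finset.Icc 1 T, ∫⁻ ω, h t (fun t i => ξ t i ω) ∂P := by
  have hm : Measurable (Function.uncurry h) := measurable_from_prod_countable_right hh
  have hlaw := (indepFun_iff_map_prod_eq_prod_map_map hτ.measurable.aemeasurable
    hξ.aemeasurable).1 hτ.indep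
  have e : ∫⁻ ω, h (τ ω) (fun t i => ξ t i ω) ∂P =
      ∫⁻ q, Function.uncurry h q ∂(P.map fun ω => (τ ω, fun t i => ξ t i ω)) :=
    (lintegral_map hm (hτ.measurable.prodMk hξ)).symm
  rw [e, hlaw, lintegral_prod _ hm.aemeasurable, hτ.law, lintegral_uniformOn_Icc]
  congr 1
  refine Finset.sum_congr rfl fun t _ => ?_
  exact lintegral_map (hh t) hξ

end Draw

/-! ### Stationarity of the output -/

section Stationarity

/-- A mean-square bound `ε²` on a real random variable yields the bound `ε` on its mean. -/
theorem integrable_and_integral_le_of_lintegral_sq_le {Ω : Type*} [MeasurableSpace Ω]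
    {P : Measure Ω} [IsProbabilityMeasure P] {X : Ω → ℝ} (hX : Measurable X) (hX0 : ∀ ω, 0 ≤ X ω)
    {ε : ℝ} (hε : 0 < ε) (h : ∫⁻ ω, ENNReal.ofReal (X ω ^ 2) ∂P ≤ ENNReal.ofReal (ε ^ 2)) :
    (Integrable X P ∧ ∫ ω, X ω ∂P ≤ ε) ∧
      (Integrable (fun ω => X ω ^ 2) P ∧ ∫ ω, X ω ^ 2 ∂P ≤ ε ^ 2) := by
  have hnn : 0 ≤ᵐ[P] fun ω => X ω ^ 2 := Filter.Eventually.of_forall fun ω => sq_nonneg _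
  have hm : AEStronglyMeasurable (fun ω => X ω ^ 2) P := (hX.pow_const 2).aestronglyMeasurable
  have hint2 : Integrable (fun ω => X ω ^ 2) P :=
    ⟨hm, (hasFiniteIntegral_iff_ofReal hnn).2 (h.trans_lt ENNReal.ofReal_lt_top)⟩
  have hle2 : ∫ ω, X ω ^ 2 ∂P ≤ ε ^ 2 := by
    rw [← ofReal_integral_eq_lintegral_ofReal hint2 hnn] at h
    exact (ENNReal.ofReal_le_ofReal_iff (by positivity)).1 h
  -- the tangent line bound of the square root at `ε²`
  have hpt : ∀ ω, X ω ≤ 1 / (2 * ε) * (ε ^ 2 + X ω ^ 2) := fun ω => by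
    rw [one_div, inv_mul_eq_div, le_div_iff₀ (by positivity)]
    nlinarith [sq_nonneg (X ω - ε)]
  have hdom : Integrable (fun ω => 1 / (2 * ε) * (ε ^ 2 + X ω ^ 2)) P :=
    ((integrable_const _).add hint2).const_mul _
  have hint : Integrable X P :=
    hdom.mono' hX.aestronglyMeasurable (Filter.Eventually.of_forall fun ω => by
      rw [Real.norm_of_nonneg (hX0 ω)]; exact hpt ω)
  refine ⟨⟨hint, (integral_mono hint hdom hpt).trans ?_⟩, hint2, hle2⟩
  rw [integral_const_mul, integral_add (integrable_const _) hint2, integral_const, probReal_univ,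
    one_smul, one_div, inv_mul_eq_div, div_le_iff₀ (by positivity)]
  linarith

/-- The choice of the minibatch size and of the number of iterations makes the accumulated descent
inequality imply a mean square of at most `ε²`. -/
theorem initial_gap_add_noise_le {ℓ κ a σ ε Δ δ D M T : ℝ} (hℓ : 0 < ℓ) (hκ : 1 ≤ κ)
    (ha : a = 1 / (16 * (κ + 1) ^ 2 * ℓ)) (hε : 0 < ε) (hΔ : 0 ≤ Δ) (hδ : δ ≤ D ^ 2)
    (hM1 : 1 ≤ M) (hM : 26 * κ * σ ^ 2 / ε ^ 2 ≤ M) (hT1 : 1 ≤ T)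
    (hT : 256 * ((κ ^ 2 * ℓ * Δ + κ * ℓ ^ 2 * D ^ 2) / ε ^ 2) ≤ T) :
    Δ + a * κ * ℓ ^ 2 * δ + (T + 1) * (3 / 2 * a * κ * (σ ^ 2 / M)) ≤ a / 2 * (T * ε ^ 2) := by
  have hκ0 : 0 < κ := by linarith
  have ha0 : 0 < a := by rw [ha]; positivity
  have hε2 : 0 < ε ^ 2 := by positivity
  have hM0 : 0 < M := by linarith
  rw [div_le_iff₀ hε2] at hM
  rw [mul_div_assoc', div_le_iff₀ hε2] at hT
  have hnoise : 26 * (κ * (σ ^ 2 / M)) ≤ ε ^ 2 := by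
    have : 26 * (κ * (σ ^ 2 / M)) = 26 * κ * σ ^ 2 / M := by ring
    rw [this, div_le_iff₀ hM0]
    linarith
  -- `T + 1 ≤ 2 * T`, so the noise takes at most a `3 / 13` share of the right-hand side
  have h1 : (T + 1) * (3 / 2 * a * κ * (σ ^ 2 / M)) ≤ 3 / 26 * a * (T * ε ^ 2) := by
    have h2 : 3 / 2 * a * κ * (σ ^ 2 / M) ≤ 3 / 52 * a * ε ^ 2 := by
      nlinarith
    have h3 := mul_le_mul_of_nonneg_left h2 (by linarith : 0 ≤ T + 1)
    have h4 : 0 ≤ (T - 1) * (3 / 52 * a * ε ^ 2) := mul_nonneg (by linarith) (by positivity)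
    linarith
  have h5 : 1 / 64 ≤ a * (κ ^ 2 * ℓ) := by
    rw [ha, one_div_mul_eq_div, le_div_iff₀ (by positivity)]
    have : (κ + 1) ^ 2 ≤ 4 * κ ^ 2 := by nlinarith
    nlinarith
  have h6 : Δ ≤ 64 * (a * (κ ^ 2 * ℓ * Δ)) := by nlinarith
  have h7 : a * κ * ℓ ^ 2 * δ ≤ a * (κ * ℓ ^ 2 * D ^ 2) := by
    have := mul_le_mul_of_nonneg_left hδ (by positivity : 0 ≤ a * κ * ℓ ^ 2)
    linarith
  have h8 := mul_le_mul_of_nonneg_left hT ha0.le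
  have h9 : 0 ≤ a * (κ * ℓ ^ 2 * D ^ 2) := by positivity
  have h10 : 0 ≤ a * (κ ^ 2 * ℓ * Δ) := by positivity
  linarith

variable {m n M : ℕ} {f : JointSpace m n → ℝ} {Y : Set (EuclideanSpace ℝ (Fin n))} {ℓ μ : ℝ}
  {Ξ Ω : Type*} [MeasurableSpace Ξ] [MeasurableSpace Ω]
  {ν : Measure Ξ} {P : Measure Ω} [IsProbabilityMeasure P]
  {G : JointSpace m n → Ξ → JointSpace m n} {σ κ a ε : ℝ} {ξ : ℕ → Fin M → Ω → Ξ}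
  {x₀ : EuclideanSpace ℝ (Fin m)} {y₀ : EuclideanSpace ℝ (Fin n)}

theorem measurable_norm_gradient_iterate (hf : NonconvexStronglyConcave f Y ℓ μ) (hn : 1 ≤ n)
    (hG : IsStochasticOracle ν f G σ) (b : ℝ) (t : ℕ) :
    Measurable fun s : ℕ → Fin M → Ξ => ‖∇ (maxFun f Y) (iterate G Y a b x₀ y₀ s t).1‖ :=
  ((hf.continuous_gradient_maxFun hn).measurable.comp
    (measurable_fst.comp (measurable_iterate hf hG.measurable t))).norm

/-- The average over `t = 1, …, T` of the mean squared gradients is at most `ε²`. The term `t = 0`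
of the telescoped sum is dropped. -/
theorem sum_Icc_lintegral_gradient_sq_le [IsProbabilityMeasure ν]
    (hf : NonconvexStronglyConcave f Y ℓ μ) (hn : 1 ≤ n)
    (hb : BddBelow (Set.range (maxFun f Y))) (hG : IsStochasticOracle ν f G σ)
    (hξ : IsIIDSample P ν ξ) (hy₀ : y₀ ∈ Y) (hε : 0 < ε) (hκ : κ = ℓ / μ)
    (ha : a = 1 / (16 * (κ + 1) ^ 2 * ℓ)) (hM1 : 1 ≤ M) (hM : 26 * κ * σ ^ 2 / ε ^ 2 ≤ M)
    {T : ℕ} (hT1 : 1 ≤ T)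
    (hT : 256 * ((κ ^ 2 * ℓ * (maxFun f Y x₀ - ⨅ x, maxFun f Y x)
      + κ * ℓ ^ 2 * Metric.diam Y ^ 2) / ε ^ 2) ≤ T) :
    ∑ t ∈ Finset.Icc 1 T, ∫⁻ ω, ENNReal.ofReal (‖∇ (maxFun f Y)
      (iterate G Y a (1 / ℓ) x₀ y₀ (fun t i => ξ t i ω) t).1‖ ^ 2) ∂P
      ≤ T * ENNReal.ofReal (ε ^ 2) := by
  have hℓ := hf.ell_pos hn
  have hκ1 : 1 ≤ κ := by rw [hκ, one_le_div hf.mu_pos]; exact hf.mu_le hn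
  have hκ0 : 0 < κ := by linarith
  have ha0 : 0 < a := by rw [ha]; positivity
  have hsum := sum_lintegral_gradient_sq_le (x₀ := x₀) (y₀ := y₀) hf hn hb hG hM1 hξ hκ ha (T + 1)
  have hscale : ∀ t, ∫⁻ ω, ENNReal.ofReal (a / 2 * ‖∇ (maxFun f Y)
      (iterate G Y a (1 / ℓ) x₀ y₀ (fun t i => ξ t i ω) t).1‖ ^ 2) ∂P
      = ENNReal.ofReal (a / 2) * ∫⁻ ω, ENNReal.ofReal (‖∇ (maxFun f Y)
      (iterate G Y a (1 / ℓ) x₀ y₀ (fun t i => ξ t i ω) t).1‖ ^ 2) ∂P := fun t => by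
    simp_rw [ENNReal.ofReal_mul (by positivity : 0 ≤ a / 2)]
    exact lintegral_const_mul _ (((measurable_norm_gradient_iterate hf hn hG _ t).pow_const
      2).ennreal_ofReal.comp hξ.measurable_path)
  simp_rw [hscale, ← Finset.mul_sum] at hsum
  generalize (fun t => ∫⁻ ω, ENNReal.ofReal (‖∇ (maxFun f Y)
    (iterate G Y a (1 / ℓ) x₀ y₀ (fun t i => ξ t i ω) t).1‖ ^ 2) ∂P) = I at hsum ⊢
  have hδ : ‖y₀ - maximizer f Y x₀‖ ^ 2 ≤ Metric.diam Y ^ 2 := by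
    rw [← dist_eq_norm]
    exact pow_le_pow_left₀ dist_nonneg
      (Metric.dist_le_diam_of_mem hf.bounded hy₀ (hf.maximizer_spec x₀).1) 2
  have hreal := initial_gap_add_noise_le (σ := σ) hℓ hκ1 ha hε (sub_nonneg.2 (ciInf_le hb x₀)) hδ
    (Nat.one_le_cast.2 hM1) hM (Nat.one_le_cast.2 hT1) hT
  have hgap : potentialGap f Y (a * κ * ℓ ^ 2) (x₀, y₀) = maxFun f Y x₀ - (⨅ x, maxFun f Y x)
      + a * κ * ℓ ^ 2 * ‖y₀ - maximizer f Y x₀‖ ^ 2 := by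
    simp only [potentialGap, potential]; ring
  have hbound : ENNReal.ofReal (a / 2) * ∑ t ∈ Finset.Icc 1 T, I t
      ≤ ENNReal.ofReal (a / 2) * ENNReal.ofReal (T * ε ^ 2) := by
    have hsub : Finset.Icc 1 T ⊆ Finset.range (T + 1) := fun t ht =>
      Finset.mem_range.2 (Nat.lt_succ_of_le (Finset.mem_Icc.1 ht).2)
    calc _ ≤ ENNReal.ofReal (a / 2) * ∑ t ∈ Finset.range (T + 1), I t :=
          mul_le_mul_right (Finset.sum_le_sum_of_subset hsub) _
      _ ≤ _ := le_add_self.trans hsum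
      _ = ENNReal.ofReal (potentialGap f Y (a * κ * ℓ ^ 2) (x₀, y₀)
            + (T + 1) * (3 / 2 * a * κ * (σ ^ 2 / M))) := by
          rw [ENNReal.ofReal_add (potentialGap_nonneg hb (by positivity) _) (by positivity),
            ENNReal.ofReal_mul (by positivity : (0 : ℝ) ≤ (T : ℝ) + 1), ← Nat.cast_succ,
            ENNReal.ofReal_natCast]
      _ ≤ ENNReal.ofReal (a / 2 * (T * ε ^ 2)) := by
          rw [hgap]
          exact ENNReal.ofReal_le_ofReal hreal
      _ = _ := ENNReal.ofReal_mul (by positivity)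
  rwa [ENNReal.mul_le_mul_iff_right (by simpa using ha0) ENNReal.ofReal_ne_top,
    ENNReal.ofReal_mul (by positivity), ENNReal.ofReal_natCast] at hbound

/-- After `T` iterations with `T` and the minibatch size `M` large enough, the iterate at a uniform
independent time in `{1, …, T}` is `ε`-stationary for `Φ`, in mean and in mean square. -/
theorem isStationaryInExpectation_sgda [IsProbabilityMeasure ν]
    (hf : NonconvexStronglyConcave f Y ℓ μ) (hn : 1 ≤ n)
    (hb : BddBelow (Set.range (maxFun f Y))) (hG : IsStochasticOracle ν f G σ)
    (hξ : IsIIDSample P ν ξ) (hy₀ : y₀ ∈ Y) (hε : 0 < ε) (hκ : κ = ℓ / μ)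
    (ha : a = 1 / (16 * (κ + 1) ^ 2 * ℓ)) (hM1 : 1 ≤ M) (hM : 26 * κ * σ ^ 2 / ε ^ 2 ≤ M)
    {T : ℕ} (hT1 : 1 ≤ T)
    (hT : 256 * ((κ ^ 2 * ℓ * (maxFun f Y x₀ - ⨅ x, maxFun f Y x)
      + κ * ℓ ^ 2 * Metric.diam Y ^ 2) / ε ^ 2) ≤ T)
    {τ : Ω → ℕ} (hτ : IsUniformDraw P ξ T τ) :
    IsStationaryInExpectation P (maxFun f Y) ε
      (fun ω => (sgda G Y a (1 / ℓ) x₀ y₀ (fun t i => ξ t i ω) (τ ω)).x) := by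
  change IsStationaryInExpectation P (maxFun f Y) ε
    (fun ω => (iterate G Y a (1 / ℓ) x₀ y₀ (fun t i => ξ t i ω) (τ ω)).1)
  have hgrad := fun t => measurable_norm_gradient_iterate (M := M) (a := a) (x₀ := x₀) (y₀ := y₀)
    hf hn hG (1 / ℓ) t
  have hjoint : Measurable (Function.uncurry fun (t : ℕ) (s : ℕ → Fin M → Ξ) =>
      ‖∇ (maxFun f Y) (iterate G Y a (1 / ℓ) x₀ y₀ s t).1‖) :=
    measurable_from_prod_countable_right hgrad
  have hX := hjoint.comp (hτ.measurable.prodMk hξ.measurable_path)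
  have hdraw := hτ.lintegral_eq hξ.measurable_path (h := fun t s => ENNReal.ofReal
    (‖∇ (maxFun f Y) (iterate G Y a (1 / ℓ) x₀ y₀ s t).1‖ ^ 2))
    fun t => ((hgrad t).pow_const 2).ennreal_ofReal
  have hle := sum_Icc_lintegral_gradient_sq_le hf hn hb hG hξ hy₀ hε hκ ha hM1 hM hT1 hT
  refine ⟨hf.differentiable_maxFun hn,
    integrable_and_integral_le_of_lintegral_sq_le hX (fun ω => norm_nonneg _) hε ?_⟩
  refine hdraw.le.trans ?_
  rw [mul_comm, ← div_eq_mul_inv]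
  exact ENNReal.div_le_of_le_mul' hle

end Stationarity

end

theorem mainTheorem3 :
    ∃ C₁ C₂ : ℝ, 0 < C₁ ∧ 0 < C₂ ∧
      ∀ (m n : ℕ), 1 ≤ n →
      ∀ (f : JointSpace m n → ℝ) (Y : Set (EuclideanSpace ℝ (Fin n))) (ℓ μ : ℝ),
      NonconvexStronglyConcave f Y ℓ μ →
      BddBelow (Set.range (maxFun f Y)) →
      ∀ (Ξ : Type*) [MeasurableSpace Ξ] (ν : Measure Ξ) [IsProbabilityMeasure ν]
        (G : JointSpace m n → Ξ → JointSpace m n) (σ : ℝ),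
      IsStochasticOracle ν f G σ →
      ∀ (x₀ : EuclideanSpace ℝ (Fin m)) (y₀ : EuclideanSpace ℝ (Fin n)), y₀ ∈ Y →
      ∀ ε : ℝ, 0 < ε →
      ∀ κ D Δ ηx ηy N : ℝ, ∀ M T₀ : ℕ,
      κ = ℓ / μ →
      D = Metric.diam Y →
      Δ = maxFun f Y x₀ - ⨅ x, maxFun f Y x →
      ηx = 1 / (16 * (κ + 1) ^ 2 * ℓ) →
      ηy = 1 / ℓ →
      M = ⌈max 1 (26 * κ * σ ^ 2 / ε ^ 2)⌉₊ →
      -- the bound on the number of iterations, up to a constant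
      N = (κ ^ 2 * ℓ * Δ + κ * ℓ ^ 2 * D ^ 2) / ε ^ 2 →
      -- the least number `T ≥ 1` of iterations with `C₁ * N ≤ T`
      T₀ = max 1 ⌈C₁ * N⌉₊ →
      ∀ (Ω : Type*) [MeasurableSpace Ω] (P : Measure Ω) [IsProbabilityMeasure P]
        (ξ : ℕ → Fin M → Ω → Ξ),
      IsIIDSample P ν ξ →
      -- from `T₀` iterations on, the output `x_τ` is `ε`-stationary in expectation
      (∀ T : ℕ, T₀ ≤ T → ∀ τ : Ω → ℕ, IsUniformDraw P ξ T τ →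
        IsStationaryInExpectation P (maxFun f Y) ε
          (fun ω => (sgda G Y ηx ηy x₀ y₀ (fun t i => ξ t i ω) (τ ω)).x)) ∧
      -- number of iterations and of stochastic gradients
      ((T₀ : ℝ) ≤ C₂ * max 1 N ∧
        ∀ ω, ((sgda G Y ηx ηy x₀ y₀ (fun t i => ξ t i ω) T₀).calls : ℝ) ≤
          C₂ * max 1 N * max 1 (κ * σ ^ 2 / ε ^ 2)) ∧
      -- the same with `N` for `max 1 N`, unless the constraint set is trivially small
      (ε ≤ ℓ * D →
        (T₀ : ℝ) ≤ C₂ * N ∧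
        ∀ ω, ((sgda G Y ηx ηy x₀ y₀ (fun t i => ξ t i ω) T₀).calls : ℝ) ≤
          C₂ * N * max 1 (κ * σ ^ 2 / ε ^ 2)) := by
  refine ⟨256, 27 * 257, by norm_num, by norm_num, ?_⟩
  intro m n hn f Y ℓ μ hf hb Ξ _ ν _ G σ hG x₀ y₀ hy₀ ε hε κ D Δ ηx ηy N M T₀ hκ hD hΔ hηx hηy
    hM hN hT₀ Ω _ P _ ξ hξ
  subst hD hΔ hηy
  have hℓ := hf.ell_pos hn
  have hκ1 : 1 ≤ κ := by rw [hκ, one_le_div hf.mu_pos]; exact hf.mu_le hn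
  have hκ0 : 0 < κ := by linarith
  have hΔ0 : 0 ≤ maxFun f Y x₀ - ⨅ x, maxFun f Y x := sub_nonneg.2 (ciInf_le hb x₀)
  have hN0 : 0 ≤ N := by rw [hN]; positivity
  have hMle : max 1 (26 * κ * σ ^ 2 / ε ^ 2) ≤ (M : ℝ) := by rw [hM]; exact Nat.le_ceil _
  have hM1 : 1 ≤ M := by exact_mod_cast (le_max_left _ _).trans hMle
  have hT₀1 : 1 ≤ T₀ := by rw [hT₀]; exact le_max_left _ _
  have hT₀N : 256 * N ≤ T₀ := by
    rw [hT₀]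
    exact (Nat.le_ceil _).trans (by exact_mod_cast le_max_right _ _)
  have hTup : (T₀ : ℝ) ≤ 257 * max 1 N := by
    rw [hT₀, Nat.cast_max, Nat.cast_one]
    have h1 := Nat.ceil_lt_add_one (by positivity : 0 ≤ 256 * N)
    have h2 := le_max_left 1 N
    have h3 := le_max_right 1 N
    exact max_le (by linarith) (by linarith)
  have hMup : (M : ℝ) ≤ 27 * max 1 (κ * σ ^ 2 / ε ^ 2) := by
    have h1 := Nat.ceil_lt_add_one (zero_le_one.trans (le_max_left 1 (26 * κ * σ ^ 2 / ε ^ 2)))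
    rw [← hM] at h1
    have h2 := le_max_left 1 (κ * σ ^ 2 / ε ^ 2)
    have h3 := le_max_right 1 (κ * σ ^ 2 / ε ^ 2)
    have h4 : 26 * κ * σ ^ 2 / ε ^ 2 = 26 * (κ * σ ^ 2 / ε ^ 2) := by ring
    have h5 : max 1 (26 * κ * σ ^ 2 / ε ^ 2) ≤ 26 * max 1 (κ * σ ^ 2 / ε ^ 2) :=
      max_le (by linarith) (by linarith)
    linarith
  have hcount : (T₀ : ℝ) ≤ 27 * 257 * max 1 N := by
    have := le_max_left 1 N
    linarith
  have hcalls : ∀ ω, ((sgda G Y ηx (1 / ℓ) x₀ y₀ (fun t i => ξ t i ω) T₀).calls : ℝ) ≤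
      27 * 257 * max 1 N * max 1 (κ * σ ^ 2 / ε ^ 2) := fun ω => by
    rw [sgda_calls, Nat.cast_mul]
    calc (T₀ : ℝ) * M ≤ (257 * max 1 N) * (27 * max 1 (κ * σ ^ 2 / ε ^ 2)) := by gcongr
      _ = _ := by ring
  refine ⟨fun T hT τ hτ => ?_, ⟨hcount, hcalls⟩, fun hεD => ?_⟩
  · refine isStationaryInExpectation_sgda hf hn hb hG hξ hy₀ hε hκ hηx hM1
      ((le_max_right _ _).trans hMle) (hT₀1.trans hT) ?_ hτ
    rw [← hN]
    exact hT₀N.trans (by exact_mod_cast hT)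
  · -- `ε ≤ ℓ * D` makes the second summand of `N` at least `κ ≥ 1`
    have hN1 : 1 ≤ N := by
      rw [hN, one_le_div (by positivity)]
      have h1 : ε ^ 2 ≤ (ℓ * Metric.diam Y) ^ 2 := pow_le_pow_left₀ hε.le hεD 2
      have h2 : (ℓ * Metric.diam Y) ^ 2 ≤ κ * (ℓ * Metric.diam Y) ^ 2 :=
        le_mul_of_one_le_left (by positivity) hκ1
      have h3 : 0 ≤ κ ^ 2 * ℓ * (maxFun f Y x₀ - ⨅ x, maxFun f Y x) := by positivity
      linarith
    rw [max_eq_right hN1] at hcount hcalls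
    exact ⟨hcount, hcalls⟩
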